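/- Let $\mathcal H$ and $\mathcal K$ be complex Hilbert spaces with inner products linear in the first variable. A contraction semigroup on $\mathcal H$ is a family $P=(P_t)_{t\ge 0}$ of bounded operators with $P_0=I$, $P_{t+s}=P_tP_s$, $\|P_t\|\le 1$ and $P_tf\to f$ as $t\downarrow 0$ for every $f$; we write $P=(e^{-tA})_{t\ge0}$ when $-A$ is its generator, and $P_\infty$ for the orthogonal projection onto $\{f: P_tf=f\ \forall t\ge 0\}$. Let $P$ and $\tilde P=(e^{-t\tilde A})_{t\ge 0}$ be contraction semigroups on $\mathcal H$ and $\mathcal K$, where $\tilde A$ is normal with spectrum $\sigma(\tilde A)$ and (unique) resolution of identity $E$ on the Borel sets of $\mathbb C$, i.e. $\tilde A=\int\gamma\,dE_\gamma$. Assume: * (Proper intertwining.) $\Lambda:\mathcal K\to\mathcal H$ is a bounded operator with $P_t\Lambda=\Lambda\tilde P_t$ for all $t\ge 0$, its range is dense in $\mathcal H$, and $E_\Omega\big(\overline{\operatorname{ran}\Lambda^*}\big)\subseteq\overline{\operatorname{ran}\Lambda^*}$ for every Borel set $\Omega\subseteq\mathbb C$. * (Spectral gap.) $\sigma(\tilde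 A)\subseteq\{\operatorname{Re}\gamma\ge0\}$ and there is a real number $\gamma_1>0$ with $$\gamma_1=\inf\{\operatorname{Re}\gamma:\ \gamma\in\sigma(\tilde A),\ \operatorname{Re}\gamma>0\}=\inf\Big\{\frac{\operatorname{Re}\langle\tilde Af,f\rangle}{\|f\|^2}:\ 0\ne f\in D(\tilde A),\ f\perp\ker\tilde A\Big\}.$$ Let $\Lambda^\dagger$ be the pseudo-inverse of $\Lambda$, i.e. the inverse of $\Lambda|_{(\ker\Lambda)^\perp}$, with domain $\operatorname{ran}\Lambda$, and let $F_\Omega=\Lambda E_\Omega\Lambda^\dagger$, an operator with domain $\operatorname{ran}\Lambda$, be the induced non-self-adjoint (nsa) resolution of identity. For $f\in\operatorname{ran}\Lambda$ and $g\in\mathcal H$, $\Omega\mapsto\langle F_\Omega f,g\rangle$ is a complex measure; $|\langle F_\gamma f,g\rangle|$ denotes its total variation. For a bounded Borel function $\varphi$ on $\sigma(\tilde A)$, $\int_{\sigma(\tilde A)}\varphi(\gamma)\,dF_\gamma$ is the linear operator $T$ with domain $\operatorname{ran}\Lambda$ determined by $\langle Tf,g\rangle=\int_{\sigma(\tilde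 A)}\varphi(\gamma)\,d\langle F_\gamma f,g\rangle$ for $f\in\operatorname{ran}\Lambda$, $g\in\mathcal H$. Suppose that $m:\sigma(\tilde A)\to\mathbb C$ is a bounded Borel function without zeros and $T_m>0$ is a constant such that (a) $\displaystyle\int_{\sigma(\tilde A)}|m(\gamma)|\,d|\langle F_\gamma f,g\rangle|\le\|f\|\,\|g\|$ for all $f\in\operatorname{ran}\Lambda$ and $g\in\mathcal H$; (b) for every $t>T_m$ the function $\gamma\mapsto e^{-\gamma t}/m(\gamma)$ is bounded on $\sigma(\tilde A)$. Then for every $t>T_m$: 1. The operator $\int_{\sigma(\tilde A)}e^{-\gamma t}\,dF_\gamma$, with domain $\operatorname{ran}\Lambda$, exists and extends to a bounded linear operator on $\mathcal H$. 2. The function $M_t^{(\gamma_1)}(\gamma)=\dfrac{e^{-\gamma t}}{m(\gamma)}\mathbf 1_{\{\operatorname{Re}\gamma\ge\gamma_1\}}$ is a bounded Borel function on $\sigma(\tilde A)$ and, with $\|M_t^{(\gamma_1)}\|_\infty=\sup_{\gamma\in\sigma(\tilde A)}|M_t^{(\gamma_1)}(\gamma)|$, $$\|P_tf-P_\infty f\|\le\|M_t^{(\gamma_1)}\|_\infty\,\|f-P_\infty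 f\|\qquad\text{for all } f\in\mathcal H.$$ If moreover $\gamma_1\in\sigma(\tilde A)$ and $|M_t^{(\gamma_1)}|$ attains its supremum over $\sigma(\tilde A)$ at $\gamma_1$, then $$\|P_tf-P_\infty f\|\le\frac{1}{|m(\gamma_1)|}\,e^{-\gamma_1t}\,\|f-P_\infty f\|\qquad\text{for all } f\in\mathcal H.$$ -/

import Mathlib

open MeasureTheory Filter Topology
open scoped NNReal ENNReal

set_option linter.unusedSectionVars false

noncomputable section

variable {H K : Type*} [NormedAddCommGroup H] [InnerProductSpace ℂ H] [CompleteSpace H]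
  [NormedAddCommGroup K] [InnerProductSpace ℂ K] [CompleteSpace K]

/-! ### Contraction semigroups, their generators and their equilibria -/

/-- A strongly continuous contraction semigroup `(P t)`, `t ≥ 0`, on a Hilbert space. -/
structure ContractionSemigroup (H : Type*) [NormedAddCommGroup H] [InnerProductSpace ℂ H] where
  /-- The operator at time `t`. -/
  toFun : ℝ≥0 → H →L[ℂ] H
  map_zero' : toFun 0 = 1
  map_add' : ∀ t s, toFun (t + s) = toFun t * toFun s
  norm_le' : ∀ t, ‖toFun t‖ ≤ 1
  tendsto' : ∀ f : H, Tendsto (fun t => toFun t f) (𝓝 0) (𝓝 f)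

namespace ContractionSemigroup

instance : CoeFun (ContractionSemigroup H) (fun _ => ℝ≥0 → H →L[ℂ] H) := ⟨toFun⟩

/-- `HasGen P f g` says that `(f - P t f) / t → g` as `t ↓ 0`. -/
def HasGen (P : ContractionSemigroup H) (f g : H) : Prop :=
  Tendsto (fun t : ℝ≥0 => (((t : ℝ)⁻¹ : ℝ) : ℂ) • (f - P t f)) (𝓝[>] 0) (𝓝 g)

theorem HasGen.unique {P : ContractionSemigroup H} {f g g' : H}
    (h : P.HasGen f g) (h' : P.HasGen f g') : g = g' :=
  tendsto_nhds_unique h h'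

theorem HasGen.add {P : ContractionSemigroup H} {f g f' g' : H}
    (h : P.HasGen f g) (h' : P.HasGen f' g') : P.HasGen (f + f') (g + g') := by
  refine (Tendsto.add h h').congr fun t => ?_
  rw [← smul_add, map_add]
  congr 1
  abel

theorem HasGen.smul {P : ContractionSemigroup H} {f g : H} (c : ℂ)
    (h : P.HasGen f g) : P.HasGen (c • f) (c • g) := by
  refine (Tendsto.const_smul h c).congr fun t => ?_
  rw [map_smul, ← smul_sub, smul_comm]

/-- The operator `A` for which `P = (e^{-tA})`, that is, `-A` is the generator of `P`:
its domain consists of all `f` for which `(f - P t f) / t` converges as `t ↓ 0`, and `A f` is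
that limit. -/
def gen (P : ContractionSemigroup H) : H →ₗ.[ℂ] H where
  domain :=
    { carrier := {f | ∃ g, P.HasGen f g}
      add_mem' := fun ⟨_, h⟩ ⟨_, h'⟩ => ⟨_, h.add h'⟩
      zero_mem' := ⟨0, by simp [HasGen]⟩
      smul_mem' := fun c _ ⟨_, h⟩ => ⟨_, h.smul c⟩ }
  toFun :=
    { toFun := fun f => f.2.choose
      map_add' := fun f f' =>
        (f + f').2.choose_spec.unique (f.2.choose_spec.add f'.2.choose_spec)
      map_smul' := fun c f => (c • f).2.choose_spec.unique (f.2.choose_spec.smul c) }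

/-- The subspace of `P`-invariant vectors. -/
def invariant (P : ContractionSemigroup H) : Submodule ℂ H where
  carrier := {f | ∀ t, P t f = f}
  add_mem' := fun h h' t => by rw [map_add, h t, h' t]
  zero_mem' := fun t => map_zero _
  smul_mem' := fun c f h t => by rw [map_smul, h t]

theorem isClosed_invariant (P : ContractionSemigroup H) :
    IsClosed (P.invariant : Set H) := by
  have h : (P.invariant : Set H) = ⋂ t, {f | P t f = f} := by
    ext f
    simp [invariant]
  rw [h]
  exact isClosed_iInter fun t => isClosed_eq (P t).continuous continuous_id

instance (P : ContractionSemigroup H) : CompleteSpace P.invariant :=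
  P.isClosed_invariant.completeSpace_coe

/-- `P_∞`, the orthogonal projection onto the subspace of `P`-invariant vectors. -/
def equilibrium (P : ContractionSemigroup H) : H →L[ℂ] H :=
  P.invariant.starProjection

end ContractionSemigroup

/-- `Λ` intertwines `P` with `Q`: `P_t Λ = Λ Q_t` for all `t ≥ 0`. -/
def Intertwines (P : ContractionSemigroup H) (Q : ContractionSemigroup K) (Λ : K →L[ℂ] H) : Prop :=
  ∀ t, P t ∘L Λ = Λ ∘L Q t

/-! ### Unbounded operators: normality, spectrum, spectral gap -/

namespace UnboundedOp

/-- A densely defined closed operator `A` is normal if `A A* = A* A` (with equal domains). The two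
sides below are the graphs of `A A*` and of `A* A`. -/
def IsNormal (A : K →ₗ.[ℂ] K) : Prop :=
  Dense (A.domain : Set K) ∧ A.IsClosed ∧
    ∀ x z : K, (∃ y, (x, y) ∈ A.adjoint.graph ∧ (y, z) ∈ A.graph) ↔
      (∃ y, (x, y) ∈ A.graph ∧ (y, z) ∈ A.adjoint.graph)

/-- The resolvent set: all `z` such that `z - A` is a bijection of the domain of `A` onto the
whole space with bounded inverse `R`. -/
def resolventSet (A : K →ₗ.[ℂ] K) : Set ℂ :=
  {z | ∃ R : K →L[ℂ] K,
    (∀ x : K, ∃ h : R x ∈ A.domain, z • R x - A ⟨R x, h⟩ = x) ∧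
    ∀ x : A.domain, R (z • (x : K) - A x) = x}

/-- The spectrum of an unbounded operator. -/
def spectrum (A : K →ₗ.[ℂ] K) : Set ℂ := (resolventSet A)ᶜ

/-- `A`, with spectrum in the closed right half-plane, has the spectral gap `γ₁ > 0`:
`γ₁` is the infimum of the positive real parts of spectral values, and also the infimum of the
Rayleigh quotients `Re ⟪A f, f⟫ / ‖f‖²` over the nonzero `f` in the domain that are orthogonal
to the kernel of `A`. -/
structure HasSpectralGap (A : K →ₗ.[ℂ] K) (γ₁ : ℝ) : Prop where
  re_nonneg : ∀ γ ∈ spectrum A, 0 ≤ γ.re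
  pos : 0 < γ₁
  isGLB_spectrum : IsGLB {r : ℝ | ∃ γ ∈ spectrum A, 0 < γ.re ∧ r = γ.re} γ₁
  isGLB_rayleigh : IsGLB {r : ℝ | ∃ f : A.domain, (f : K) ≠ 0 ∧
    (∀ h : A.domain, A h = 0 → inner ℂ (h : K) (f : K) = 0) ∧
    r = (inner ℂ (f : K) (A f)).re / ‖(f : K)‖ ^ 2} γ₁

end UnboundedOp

/-! ### Resolutions of identity -/

/-- A (self-adjoint) resolution of identity on the Borel sets of `ℂ`: a strongly countably additive
multiplicative family of orthogonal projections with `E ∅ = 0` and `E ℂ = I`. As for Mathlib's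
vector measures, the irrelevant value at a non-Borel set is `0`. -/
structure ResolutionOfIdentity (K : Type*) [NormedAddCommGroup K] [InnerProductSpace ℂ K]
    [CompleteSpace K] where
  /-- The projection attached to a set. -/
  toFun : Set ℂ → K →L[ℂ] K
  not_measurable' : ∀ Ω, ¬ MeasurableSet Ω → toFun Ω = 0
  isStarProjection' : ∀ Ω, MeasurableSet Ω → IsStarProjection (toFun Ω)
  empty' : toFun ∅ = 0
  univ' : toFun Set.univ = 1
  inter' : ∀ Ω₁ Ω₂, MeasurableSet Ω₁ → MeasurableSet Ω₂ →
    toFun (Ω₁ ∩ Ω₂) = toFun Ω₁ * toFun Ω₂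
  iUnion' : ∀ Ω : ℕ → Set ℂ, (∀ i, MeasurableSet (Ω i)) → Pairwise (Function.onFun Disjoint Ω) →
    ∀ x : K, HasSum (fun i => toFun (Ω i) x) (toFun (⋃ i, Ω i) x)

namespace ResolutionOfIdentity

instance : CoeFun (ResolutionOfIdentity K) (fun _ => Set ℂ → K →L[ℂ] K) := ⟨toFun⟩

/-- The complex measure `Ω ↦ ⟪E_Ω x, y⟫` (linear in `x`; Mathlib's inner product is linear in its
second argument). -/
def measure (E : ResolutionOfIdentity K) (x y : K) : VectorMeasure ℂ ℂ where
  measureOf' := fun Ω => inner ℂ y (E Ω x)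
  empty' := by simp [E.empty']
  not_measurable' := fun Ω h => by simp [E.not_measurable' Ω h]
  m_iUnion' := fun Ω h h' => (innerSL ℂ y).hasSum (E.iUnion' Ω h h' x)

/-- `E` is the resolution of identity of the operator `A`, that is, `A = ∫ γ dE_γ`: the domain of
`A` is `{x : ∫ |γ|² d⟪E_γ x, x⟫ < ∞}`, and `⟪A x, y⟫ = ∫ γ d⟪E_γ x, y⟫` for `x` in the domain and
all `y`. (The measure `⟪E_γ x, x⟫` is nonnegative, hence it is its own total variation.) These two
properties determine `E`, and every normal operator has such an `E` by the spectral theorem. -/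
structure IsResolutionOf (E : ResolutionOfIdentity K) (A : K →ₗ.[ℂ] K) : Prop where
  mem_domain_iff : ∀ x : K,
    x ∈ A.domain ↔ ∫⁻ γ, ‖γ‖ₑ ^ 2 ∂(E.measure x x).variation < ∞
  inner_eq : ∀ (x : A.domain) (y : K),
    inner ℂ y (A x) = ∫ᵛ γ, γ ∂[ContinuousLinearMap.mul ℝ ℂ; E.measure (x : K) y]

end ResolutionOfIdentity

/-- `Λ` is proper with respect to `E`: it has dense range, and every `E_Ω` leaves the closure of
the range of `Λ*` invariant. -/
structure IsProper (Λ : K →L[ℂ] H) (E : ResolutionOfIdentity K) : Prop where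
  dense : DenseRange Λ
  invariant : ∀ Ω, MeasurableSet Ω →
    ∀ x ∈ closure (Set.range (ContinuousLinearMap.adjoint Λ)),
      E Ω x ∈ closure (Set.range (ContinuousLinearMap.adjoint Λ))

/-- The pseudo-inverse `Λ†`, the inverse of the restriction of `Λ` to the orthogonal complement of
its kernel. Its domain is the range of `Λ`. -/
def pseudoInverse (Λ : K →L[ℂ] H) : H →ₗ.[ℂ] K :=
  (LinearPMap.mk Λ.kerᗮ ((Λ : K →ₗ[ℂ] H).domRestrict Λ.kerᗮ)).inverse

theorem pseudoInverse_domain (Λ : K →L[ℂ] H) :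
    (pseudoInverse Λ).domain = LinearMap.range (Λ : K →ₗ[ℂ] H) := by
  rw [pseudoInverse, LinearPMap.inverse_domain]
  apply le_antisymm
  · rintro _ ⟨x, rfl⟩
    exact ⟨x, rfl⟩
  · rintro _ ⟨x, rfl⟩
    have : CompleteSpace Λ.ker := Λ.isClosed_ker.completeSpace_coe
    obtain ⟨y, hy, z, hz, rfl⟩ := Λ.ker.exists_add_mem_mem_orthogonal x
    refine ⟨⟨z, hz⟩, ?_⟩
    have hy' : Λ y = 0 := hy
    simp [hy']

/-- The nsa resolution of identity `F_Ω = Λ E_Ω Λ†` induced by `Λ` and `E`, an operator whose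
domain is that of `Λ†`, the range of `Λ`. -/
def inducedF (Λ : K →L[ℂ] H) (E : ResolutionOfIdentity K) (Ω : Set ℂ) : H →ₗ.[ℂ] H :=
  ((Λ ∘L E Ω : K →L[ℂ] H) : K →ₗ[ℂ] H).compPMap (pseudoInverse Λ)

/-- The complex measure `Ω ↦ ⟪F_Ω f, g⟫` for `f` in the range of `Λ` and `g` in `H`. -/
def inducedMeasure (Λ : K →L[ℂ] H) (E : ResolutionOfIdentity K)
    (f : (pseudoInverse Λ).domain) (g : H) : VectorMeasure ℂ ℂ where
  measureOf' := fun Ω => inner ℂ g (inducedF Λ E Ω f)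
  empty' := by
    change inner ℂ g (Λ (E ∅ (pseudoInverse Λ f))) = 0
    simp [E.empty']
  not_measurable' := fun Ω h => by
    change inner ℂ g (Λ (E Ω (pseudoInverse Λ f))) = 0
    simp [E.not_measurable' Ω h]
  m_iUnion' := fun Ω h h' =>
    ((innerSL ℂ g) ∘L Λ).hasSum (E.iUnion' Ω h h' (pseudoInverse Λ f))

/-- `T` is the spectral integral `∫_S φ(γ) dF_γ`: it has domain the range of `Λ`, and
`⟪T f, g⟫ = ∫_S φ(γ) d⟪F_γ f, g⟫` (a convergent integral) for `f` in the range of `Λ`, `g` in `H`. -/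
structure IsSpectralIntegral (Λ : K →L[ℂ] H) (E : ResolutionOfIdentity K) (S : Set ℂ) (φ : ℂ → ℂ)
    (T : H →ₗ.[ℂ] H) : Prop where
  domain_eq : T.domain = LinearMap.range (Λ : K →ₗ[ℂ] H)
  integrable : ∀ (f : (pseudoInverse Λ).domain) (g : H), (inducedMeasure Λ E f g).IntegrableOn φ S
  inner_eq : ∀ (f : (pseudoInverse Λ).domain) (g : H) (hf : (f : H) ∈ T.domain),
    inner ℂ g (T ⟨f, hf⟩) =
      ∫ᵛ γ in S, φ γ ∂[ContinuousLinearMap.mul ℝ ℂ; inducedMeasure Λ E f g]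

/-! ### Bounded Borel functions on the spectrum -/

/-- `φ` restricts to a bounded Borel function on `S`. -/
def IsBoundedBorelOn (S : Set ℂ) (φ : ℂ → ℂ) : Prop :=
  Measurable (S.domRestrict φ) ∧ ∃ C : ℝ, ∀ γ ∈ S, ‖φ γ‖ ≤ C

/-- The uniform norm of `φ` on `S` (to be used only for `φ` bounded on `S`). -/
def supNormOn (S : Set ℂ) (φ : ℂ → ℂ) : ℝ := ⨆ γ : S, ‖φ γ‖

/-- The function `γ ↦ e^{-γ t} / m(γ)`. -/
def expQuot (m : ℂ → ℂ) (t : ℝ≥0) (γ : ℂ) : ℂ := Complex.exp (-(γ * ((t : ℝ) : ℂ))) / m γ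

/-- The function `M_t^{(γ₁)}`: `γ ↦ e^{-γ t} / m(γ) · 1_{Re γ ≥ γ₁}`. -/
def gapQuot (m : ℂ → ℂ) (γ₁ : ℝ) (t : ℝ≥0) : ℂ → ℂ :=
  Set.indicator {γ : ℂ | γ₁ ≤ γ.re} (expQuot m t)

end

open MeasureTheory Filter Topology
open scoped NNReal ENNReal

noncomputable section

variable {H K : Type*} [NormedAddCommGroup H] [InnerProductSpace ℂ H] [CompleteSpace H]
  [NormedAddCommGroup K] [InnerProductSpace ℂ K] [CompleteSpace K]

/-! ### Integrals against complex measures -/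

section ComplexMeasureIntegral

variable {X : Type*} [MeasurableSpace X] {μ ν : VectorMeasure X ℂ}

/-! The engine is the weak formula `⟪Q_t x, y⟫ = ∫ e^{-γt} d⟪E_γ x, y⟫`, with `Q` the normal
semigroup and `A` its `gen` (`inner_semigroup_apply`). For bounded `S` the operator `B = A E_S` is
bounded, and `exp(-sB) E_S x` solves the Cauchy problem of `Q`. Uniqueness of solutions, which needs
only contractivity, gives the formula on `ran E_S`, and an exhaustion by balls gives it everywhere.
Intertwining turns it into a formula for `⟪P_t Λx, g⟫`, so the nsa integral of `e^{-γt}` is `P_t` on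
`ran Λ`, and `P_t` itself is the bounded extension.

For the decay, `E` lives on the spectrum, and the two infima of the gap hypothesis together leave no
mass in `{Re γ < γ₁}` except at `0` (`apply_gap`). The atom at `0` is the equilibrium, `P_∞ Λ = Λ
E_{0}` (`equilibrium_apply`). For `x ⊥ ker Λ` put `y = E_{0}ᶜ x`. Properness keeps `y ⊥ ker Λ`, so
`Λ†Λy = y` and the measures of `F` at `Λy` are those of `E` at `y`, carried by `{Re γ ≥ γ₁}`. There
`|e^{-γt}| ≤ ‖M_t‖ |m(γ)|`, so hypothesis (a) gives `|⟪P_t Λy, g⟫| ≤ ‖M_t‖ ‖Λy‖ ‖g‖`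
(`norm_semigroup_apply_le`). Density of `ran Λ` finishes. -/

theorem integral_complex_const_mul {f : X → ℂ} (hf : μ.Integrable f) (c : ℂ) :
    ∫ᵛ x, c * f x ∂[ContinuousLinearMap.mul ℝ ℂ; μ] =
      c * ∫ᵛ x, f x ∂[ContinuousLinearMap.mul ℝ ℂ; μ] := by
  have h1 := VectorMeasure.integral_continuousLinearMap_comp (B := ContinuousLinearMap.mul ℝ ℂ)
    (C := ContinuousLinearMap.mul ℝ ℂ c) hf
  have h2 := VectorMeasure.continuousLinearMap_apply_integral (B := ContinuousLinearMap.mul ℝ ℂ)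
    (C := ContinuousLinearMap.mul ℝ ℂ c) hf
  simp only [ContinuousLinearMap.mul_apply'] at h1 h2
  rw [h1, h2]
  congr 1
  ext
  simp [mul_assoc]

theorem integrable_of_measurable_of_bound [IsFiniteMeasure μ.variation] {f : X → ℂ}
    (hf : Measurable f) {C : ℝ} (hC : ∀ x, ‖f x‖ ≤ C) : μ.Integrable f :=
  MeasureTheory.Integrable.of_bound hf.aestronglyMeasurable C (Eventually.of_forall hC)

theorem integrableOn_of_bound [IsFiniteMeasure μ.variation] {s : Set X} (hs : MeasurableSet s)
    {f : X → ℂ} (hf : Measurable f) {C : ℝ} (hC : ∀ x ∈ s, ‖f x‖ ≤ C) : μ.IntegrableOn f s := by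
  rw [VectorMeasure.IntegrableOn, VectorMeasure.Integrable, VectorMeasure.variation_restrict hs]
  exact MeasureTheory.Integrable.of_bound hf.aestronglyMeasurable C
    ((ae_restrict_iff' hs).2 (Eventually.of_forall hC))

/-- Change of density: if `ν = ρ μ`, then `∫ φ dν = ∫ φ ρ dμ`. -/
theorem integral_of_eq_density [IsFiniteMeasure μ.variation] [IsFiniteMeasure ν.variation]
    {ρ : X → ℂ} (hρ : Measurable ρ) {R : ℝ} (hR : ∀ x, ‖ρ x‖ ≤ R)
    (h : ∀ s, MeasurableSet s → ν s = ∫ᵛ x in s, ρ x ∂[ContinuousLinearMap.mul ℝ ℂ; μ])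
    {φ : X → ℂ} (hφ : Measurable φ) {C : ℝ} (hC : ∀ x, ‖φ x‖ ≤ C) :
    ∫ᵛ x, φ x ∂[ContinuousLinearMap.mul ℝ ℂ; ν] =
      ∫ᵛ x, φ x * ρ x ∂[ContinuousLinearMap.mul ℝ ℂ; μ] := by
  have hbd : ∀ g : SimpleFunc X ℂ, ∃ C, ∀ x, ‖g x‖ ≤ C := fun g => by
    obtain ⟨C, hC⟩ := (g.map fun z => ‖z‖).exists_forall_le
    exact ⟨C, hC⟩
  have hint : ∀ {g : X → ℂ}, Measurable g → ∀ {C : ℝ}, (∀ x, ‖g x‖ ≤ C) →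
      μ.Integrable fun x => g x * ρ x := fun {g} hg {C} hC =>
    integrable_of_measurable_of_bound (hg.mul hρ) (C := C * R) fun x => by
      rw [norm_mul]
      exact mul_le_mul (hC x) (hR x) (norm_nonneg _) ((norm_nonneg _).trans (hC x))
  -- By linearity only indicators matter, and for them the claim is the hypothesis `h`. The general
  -- case is dominated convergence on both sides along bounded simple approximations.
  have hsimple : ∀ g : SimpleFunc X ℂ, ∫ᵛ x, g x ∂[ContinuousLinearMap.mul ℝ ℂ; ν] =
      ∫ᵛ x, g x * ρ x ∂[ContinuousLinearMap.mul ℝ ℂ; μ] := by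
    intro g
    induction g using SimpleFunc.induction with
    | const c hs =>
      rename_i s
      have e1 : ∀ x, (SimpleFunc.piecewise s hs (SimpleFunc.const X c) (SimpleFunc.const X 0)) x
          = s.indicator (fun _ => c) x := fun x => by
        rw [SimpleFunc.coe_piecewise]
        by_cases hx : x ∈ s <;> simp [hx]
      simp only [e1]
      rw [VectorMeasure.integral_indicator_const c hs]
      have e2 : ∀ x, s.indicator (fun _ => c) x * ρ x = s.indicator (fun x => c * ρ x) x :=
        fun x => by by_cases hx : x ∈ s <;> simp [hx]
      simp only [e2]
      rw [VectorMeasure.integral_indicator hs, integral_complex_const_mul, ← h s hs]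
      · simp
      · exact (integrable_of_measurable_of_bound hρ hR).restrict
    | add _ hf hg =>
      rename_i f g _
      obtain ⟨C₁, h₁⟩ := hbd f
      obtain ⟨C₂, h₂⟩ := hbd g
      simp only [SimpleFunc.coe_add, Pi.add_apply, add_mul]
      rw [VectorMeasure.integral_fun_add (integrable_of_measurable_of_bound f.measurable h₁)
        (integrable_of_measurable_of_bound g.measurable h₂),
        VectorMeasure.integral_fun_add (hint f.measurable h₁) (hint g.measurable h₂), hf, hg]
  have hφ' := hφ.stronglyMeasurable
  have hlim : ∀ x, Tendsto (fun n => hφ'.approxBounded C n x) atTop (𝓝 (φ x)) := fun x =>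
    hφ'.tendsto_approxBounded_of_norm_le (hC x)
  -- On an empty space `C` may be negative; a point of `X` forces `0 ≤ C`.
  rcases isEmpty_or_nonempty X with hX | ⟨⟨x₀⟩⟩
  · rw [VectorMeasure.integral_of_isEmpty, VectorMeasure.integral_of_isEmpty]
  have hC0 : 0 ≤ C := (norm_nonneg _).trans (hC x₀)
  have hbound : ∀ n x, ‖hφ'.approxBounded C n x‖ ≤ C := fun n x =>
    hφ'.norm_approxBounded_le hC0 n x
  have l1 : Tendsto (fun n => ∫ᵛ x, hφ'.approxBounded C n x ∂[ContinuousLinearMap.mul ℝ ℂ; ν])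
      atTop (𝓝 (∫ᵛ x, φ x ∂[ContinuousLinearMap.mul ℝ ℂ; ν])) :=
    VectorMeasure.tendsto_integral_filter_of_norm_le_const
    (Eventually.of_forall fun n => (hφ'.approxBounded C n).measurable.aestronglyMeasurable)
    ⟨C, Eventually.of_forall fun n => Eventually.of_forall (hbound n)⟩
    (Eventually.of_forall hlim)
  have l2 : Tendsto
      (fun n => ∫ᵛ x, hφ'.approxBounded C n x * ρ x ∂[ContinuousLinearMap.mul ℝ ℂ; μ])
      atTop (𝓝 (∫ᵛ x, φ x * ρ x ∂[ContinuousLinearMap.mul ℝ ℂ; μ])) :=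
    VectorMeasure.tendsto_integral_filter_of_norm_le_const
    (Eventually.of_forall fun n =>
      ((hφ'.approxBounded C n).measurable.mul hρ).aestronglyMeasurable)
    ⟨C * R, Eventually.of_forall fun n => Eventually.of_forall fun x => by
      rw [norm_mul]
      exact mul_le_mul (hbound n x) (hR x) (norm_nonneg _) hC0⟩
    (Eventually.of_forall fun x => (hlim x).mul_const _)
  refine tendsto_nhds_unique l1 (l2.congr fun n => (hsimple _).symm)

end ComplexMeasureIntegral

/-! ### Scalar measures of a resolution of identity -/

namespace ResolutionOfIdentity

variable (E : ResolutionOfIdentity K) {S : Set ℂ} {x y : K}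

theorem measure_apply (x y : K) (S : Set ℂ) : E.measure x y S = inner ℂ y (E S x) := rfl

theorem inner_apply_left (hS : MeasurableSet S) (x y : K) :
    inner ℂ (E S x) y = inner ℂ x (E S y) := by
  have h := (E.isStarProjection' S hS).isSelfAdjoint
  rw [← ContinuousLinearMap.adjoint_inner_right, ContinuousLinearMap.isSelfAdjoint_iff'.1 h]

theorem apply_apply (hS : MeasurableSet S) {T : Set ℂ} (hT : MeasurableSet T) (x : K) :
    E S (E T x) = E (S ∩ T) x := by
  rw [E.inter' S T hS hT]
  rfl

theorem apply_self_apply (hS : MeasurableSet S) (x : K) : E S (E S x) = E S x := by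
  rw [E.apply_apply hS hS, Set.inter_self]

theorem inner_apply_self (hS : MeasurableSet S) (x y : K) :
    inner ℂ y (E S x) = inner ℂ (E S y) (E S x) := by
  rw [E.inner_apply_left hS, E.apply_self_apply hS]

theorem inner_self_apply (hS : MeasurableSet S) (x : K) :
    inner ℂ x (E S x) = ((‖E S x‖ ^ 2 : ℝ) : ℂ) := by
  rw [E.inner_apply_self hS, inner_self_eq_norm_sq_to_K]
  norm_cast

theorem norm_apply_le (S : Set ℂ) (x : K) : ‖E S x‖ ≤ ‖x‖ := by
  by_cases hS : MeasurableSet S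
  · rcases eq_or_lt_of_le (norm_nonneg (E S x)) with h | h
    · rw [← h]
      exact norm_nonneg x
    · have h1 : ‖inner ℂ x (E S x)‖ = ‖E S x‖ ^ 2 := by
        rw [E.inner_self_apply hS, Complex.norm_real, Real.norm_of_nonneg (sq_nonneg _)]
      have h2 := norm_inner_le_norm (𝕜 := ℂ) x (E S x)
      nlinarith
  · simp [E.not_measurable' S hS]

/-- The positive measure `Ω ↦ ‖E_Ω x‖²`. -/
def positiveMeasure (x : K) : Measure ℂ :=
  Measure.ofMeasurable (fun S _ => ENNReal.ofReal (‖E S x‖ ^ 2)) (by simp [E.empty'])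
    (fun f hf hd => by
      have h := Complex.hasSum_re ((innerSL ℂ x).hasSum (E.iUnion' f hf hd x))
      have e : ∀ {T}, MeasurableSet T → (innerSL ℂ x (E T x)).re = ‖E T x‖ ^ 2 := fun hT => by
        rw [innerSL_apply_apply, E.inner_self_apply hT, Complex.ofReal_re]
      rw [e (MeasurableSet.iUnion hf)] at h
      have h' : HasSum (fun i => ‖E (f i) x‖ ^ 2) (‖E (⋃ i, f i) x‖ ^ 2) := by
        convert h using 2 with i
        exact (e (hf i)).symm
      rw [← h'.tsum_eq, ENNReal.ofReal_tsum_of_nonneg (fun i => sq_nonneg _) h'.summable])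

theorem positiveMeasure_apply (hS : MeasurableSet S) (x : K) :
    E.positiveMeasure x S = ENNReal.ofReal (‖E S x‖ ^ 2) :=
  Measure.ofMeasurable_apply S hS

theorem apply_eq_zero_of_positiveMeasure (hS : MeasurableSet S)
    (h : E.positiveMeasure x S = 0) : E S x = 0 := by
  rw [E.positiveMeasure_apply hS, ENNReal.ofReal_eq_zero] at h
  have := le_antisymm h (sq_nonneg _)
  simpa using this

theorem apply_eq_zero_iff (hS : MeasurableSet S) :
    E S = 0 ↔ ∀ x, E.positiveMeasure x S = 0 := by
  refine ⟨fun h x => ?_, fun h => ?_⟩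
  · rw [E.positiveMeasure_apply hS, h]
    simp
  · ext x
    exact E.apply_eq_zero_of_positiveMeasure hS (h x)

theorem apply_eq_zero_mono {T : Set ℂ} (hS : MeasurableSet S) (hT : MeasurableSet T) (hST : S ⊆ T)
    (h : E T = 0) : E S = 0 := by
  rw [← Set.inter_eq_left.2 hST, E.inter' S T hS hT, h, mul_zero]

theorem apply_union_eq_zero {T : Set ℂ} (hS : MeasurableSet S) (hT : MeasurableSet T)
    (h : E S = 0) (h' : E T = 0) : E (S ∪ T) = 0 := by
  rw [E.apply_eq_zero_iff (hS.union hT)]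
  exact fun x => measure_union_null ((E.apply_eq_zero_iff hS).1 h x)
    ((E.apply_eq_zero_iff hT).1 h' x)

/-- A measurable set which is locally null for `E` is null for `E`. -/
theorem apply_eq_zero_of_locally (hS : MeasurableSet S)
    (h : ∀ z ∈ S, ∃ r > 0, E (Metric.closedBall z r ∩ S) = 0) : E S = 0 := by
  ext x
  -- Passing to the positive measures `‖E_Ω x‖²` allows a Lindelöf argument: locally null sets are
  -- null.
  refine E.apply_eq_zero_of_positiveMeasure hS (measure_null_of_locally_null _ fun z hz => ?_)
  obtain ⟨r, hr, h0⟩ := h z hz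
  refine ⟨Metric.closedBall z r ∩ S, inter_mem (nhdsWithin_le_nhds
    (Metric.closedBall_mem_nhds z hr)) self_mem_nhdsWithin, ?_⟩
  rw [E.positiveMeasure_apply (Metric.isClosed_closedBall.measurableSet.inter hS), h0]
  simp

/-- Since `⟪E_S x, y⟫ = ⟪E_S x, E_S y⟫`, Cauchy–Schwarz and the weighted AM–GM inequality bound it
by an expression additive in `S`, hence by a measure. The weight `c` is left free to be optimised.
-/
theorem variation_measure_le (x y : K) {c : ℝ} (hc : 0 < c) :
    (E.measure x y).variation ≤ (2⁻¹ : ℝ≥0∞) • (ENNReal.ofReal c • E.positiveMeasure x +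
      ENNReal.ofReal c⁻¹ • E.positiveMeasure y) := by
  refine VectorMeasure.variation_le_of_forall_enorm_le fun S hS => ?_
  rw [measure_apply, Measure.smul_apply, Measure.add_apply, Measure.smul_apply, Measure.smul_apply,
    E.positiveMeasure_apply hS, E.positiveMeasure_apply hS, smul_eq_mul, smul_eq_mul, smul_eq_mul,
    ← ENNReal.ofReal_mul hc.le, ← ENNReal.ofReal_mul (inv_pos.2 hc).le,
    ← ENNReal.ofReal_add (by positivity) (by positivity), ← ofReal_norm,
    show (2⁻¹ : ℝ≥0∞) = ENNReal.ofReal 2⁻¹ by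
      rw [ENNReal.ofReal_inv_of_pos two_pos, ENNReal.ofReal_ofNat],
    ← ENNReal.ofReal_mul (by norm_num)]
  refine ENNReal.ofReal_le_ofReal ?_
  rw [E.inner_apply_self hS]
  refine (norm_inner_le_norm _ _).trans ?_
  have h : 0 ≤ c⁻¹ * (c * ‖E S x‖ - ‖E S y‖) ^ 2 := by positivity
  have h' : c⁻¹ * (c * ‖E S x‖ - ‖E S y‖) ^ 2 =
      c * ‖E S x‖ ^ 2 + c⁻¹ * ‖E S y‖ ^ 2 - 2 * (‖E S y‖ * ‖E S x‖) := by
    field_simp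
    ring
  linarith

theorem variation_measure_univ_le (x y : K) :
    (E.measure x y).variation Set.univ ≤ ENNReal.ofReal (‖x‖ * ‖y‖) := by
  rcases eq_or_ne x 0 with rfl | hx
  · have : E.measure 0 y = 0 := by
      ext S hS
      simp [measure_apply]
    simp [this]
  rcases eq_or_ne y 0 with rfl | hy
  · have : E.measure x 0 = 0 := by
      ext S hS
      simp [measure_apply]
    simp [this]
  have hx' : 0 < ‖x‖ := norm_pos_iff.2 hx
  have hy' : 0 < ‖y‖ := norm_pos_iff.2 hy
  -- The optimal weight: both terms of the AM–GM bound then equal `‖x‖ ‖y‖` in total mass.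
  have hc : 0 < ‖y‖ / ‖x‖ := div_pos hy' hx'
  refine (E.variation_measure_le x y hc Set.univ).trans (le_of_eq ?_)
  rw [Measure.smul_apply, Measure.add_apply, Measure.smul_apply, Measure.smul_apply,
    E.positiveMeasure_apply .univ, E.positiveMeasure_apply .univ, smul_eq_mul, smul_eq_mul,
    smul_eq_mul, ← ENNReal.ofReal_mul hc.le, ← ENNReal.ofReal_mul (inv_pos.2 hc).le,
    ← ENNReal.ofReal_add (by positivity) (by positivity),
    show (2⁻¹ : ℝ≥0∞) = ENNReal.ofReal 2⁻¹ by
      rw [ENNReal.ofReal_inv_of_pos two_pos, ENNReal.ofReal_ofNat],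
    ← ENNReal.ofReal_mul (by norm_num), E.univ']
  congr 1
  simp only [one_apply_eq_self]
  field_simp
  ring

instance (x y : K) : IsFiniteMeasure (E.measure x y).variation :=
  ⟨(E.variation_measure_univ_le x y).trans_lt ENNReal.ofReal_lt_top⟩

theorem measure_apply_left (hS : MeasurableSet S) (x y : K) :
    E.measure (E S x) y = (E.measure x y).restrict S := by
  ext T hT
  rw [VectorMeasure.restrict_apply _ hS hT, measure_apply, measure_apply, E.apply_apply hT hS]

theorem measure_apply_right (hS : MeasurableSet S) (x y : K) :
    E.measure x (E S y) = (E.measure x y).restrict S := by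
  ext T hT
  rw [VectorMeasure.restrict_apply _ hS hT, measure_apply, measure_apply, E.inner_apply_left hS,
    E.apply_apply hS hT, Set.inter_comm]

theorem measure_eq_restrict (hS : MeasurableSet S) (h : E Sᶜ = 0) (x y : K) :
    E.measure x y = (E.measure x y).restrict S := by
  ext T hT
  rw [VectorMeasure.restrict_apply _ hS hT]
  have h1 := VectorMeasure.of_union (v := E.measure x y)
    (Set.disjoint_of_subset Set.inter_subset_right Set.inter_subset_right
      (disjoint_compl_right : Disjoint S Sᶜ)) (hT.inter hS) (hT.inter hS.compl)
  rw [Set.inter_union_compl] at h1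
  rw [h1, E.measure_apply x y (T ∩ Sᶜ), E.inter' _ _ hT hS.compl, h]
  simp

theorem apply_add_compl (hS : MeasurableSet S) (x : K) : E S x + E Sᶜ x = x := by
  refine ext_inner_left ℂ fun y => ?_
  rw [inner_add_right]
  have h := VectorMeasure.of_union (v := E.measure x y) (disjoint_compl_right : Disjoint S Sᶜ)
    hS hS.compl
  rw [Set.union_compl_self, measure_apply, measure_apply, measure_apply, E.univ'] at h
  exact h.symm

end ResolutionOfIdentity

/-! ### Spectral subspaces of an operator with a resolution of identity -/

namespace ResolutionOfIdentity.IsResolutionOf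

variable {E : ResolutionOfIdentity K} {A : K →ₗ.[ℂ] K} (hE : E.IsResolutionOf A)
  {S : Set ℂ} {z : ℂ} {r : ℝ}

include hE

theorem apply_mem_domain (hS : MeasurableSet S) (hSr : S ⊆ Metric.closedBall z r) (x : K) :
    E S x ∈ A.domain := by
  rw [hE.mem_domain_iff, E.measure_apply_left hS, E.measure_apply_right hS,
    VectorMeasure.variation_restrict hS, VectorMeasure.variation_restrict hS,
    Measure.restrict_restrict hS, Set.inter_self]
  have hb : ∀ γ ∈ S, ‖γ‖ₑ ^ 2 ≤ ENNReal.ofReal (r + ‖z‖) ^ 2 := fun γ hγ => by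
    gcongr
    rw [← ofReal_norm]
    refine ENNReal.ofReal_le_ofReal ?_
    have h1 := hSr hγ
    rw [mem_closedBall_iff_norm] at h1
    calc ‖γ‖ = ‖(γ - z) + z‖ := by rw [sub_add_cancel]
      _ ≤ r + ‖z‖ := (norm_add_le _ _).trans (by gcongr)
  refine (setLIntegral_mono' hS hb).trans_lt ?_
  rw [setLIntegral_const]
  exact ENNReal.mul_lt_top (by finiteness) (measure_lt_top _ _)

theorem inner_apply_sub (hS : MeasurableSet S) (hSr : S ⊆ Metric.closedBall z r) (w : ℂ)
    (x y : K) :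
    inner ℂ y (A ⟨E S x, hE.apply_mem_domain hS hSr x⟩ - w • E S x) =
      ∫ᵛ γ in S, (γ - w) ∂[ContinuousLinearMap.mul ℝ ℂ; E.measure x y] := by
  have hb : ∀ γ ∈ S, ‖γ‖ ≤ r + ‖z‖ := fun γ hγ => by
    have h1 := hSr hγ
    rw [mem_closedBall_iff_norm] at h1
    calc ‖γ‖ = ‖(γ - z) + z‖ := by rw [sub_add_cancel]
      _ ≤ r + ‖z‖ := (norm_add_le _ _).trans (by gcongr)
  rw [inner_sub_right, hE.inner_eq, inner_smul_right, E.measure_apply_left hS,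
    VectorMeasure.integral_fun_sub (integrableOn_of_bound hS (f := fun γ => γ) measurable_id hb)
      (integrableOn_of_bound hS measurable_const (C := ‖w‖) fun _ _ => le_rfl),
    VectorMeasure.setIntegral_const]
  rfl

/-- Pairing `w = (A - z) E_S x` with itself gives `‖w‖² = ∫_S (γ - z) dμ` with `|γ - z| ≤ r` on `S`
and total variation of `μ` at most `‖E_S x‖ ‖w‖`. -/
theorem norm_apply_sub_le (hS : MeasurableSet S) (hSr : S ⊆ Metric.closedBall z r) (hr : 0 ≤ r)
    (x : K) :
    ‖A ⟨E S x, hE.apply_mem_domain hS hSr x⟩ - z • E S x‖ ≤ r * ‖E S x‖ := by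
  set w := A ⟨E S x, hE.apply_mem_domain hS hSr x⟩ - z • E S x with hw
  have h1 := hE.inner_apply_sub hS hSr z x w
  rw [← hw] at h1
  -- Replacing `x` by `E_S x` yields the factor `‖E_S x‖` instead of `‖x‖`, so that later estimates
  -- can absorb it.
  have h2 : (E.measure x w).restrict S = (E.measure (E S x) w).restrict S := by
    rw [← E.measure_apply_left hS, ← E.measure_apply_left hS, E.apply_self_apply hS]
  rw [h2] at h1
  have h3 := VectorMeasure.norm_setIntegral_le_of_norm_le_const (μ := E.measure (E S x) w)
    (B := ContinuousLinearMap.mul ℝ ℂ) (f := fun γ => γ - z) (C := r) (s := S)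
    (fun γ hγ => mem_closedBall_iff_norm.1 (hSr hγ))
  rw [← h1, inner_self_eq_norm_sq_to_K] at h3
  have h4 : (E.measure (E S x) w).variation.real S ≤ ‖E S x‖ * ‖w‖ :=
    ENNReal.toReal_le_of_le_ofReal (by positivity)
      ((measure_mono (Set.subset_univ S)).trans (E.variation_measure_univ_le _ _))
  have h5 : ‖w‖ ^ 2 ≤ r * (‖E S x‖ * ‖w‖) := by
    refine le_trans (le_of_eq ?_) (h3.trans ?_)
    · simp
    · have : ‖ContinuousLinearMap.mul ℝ ℂ‖ ≤ 1 := ContinuousLinearMap.opNorm_mul_le ℝ ℂ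
      calc r * ‖ContinuousLinearMap.mul ℝ ℂ‖ * (E.measure (E S x) w).variation.real S
          ≤ r * 1 * (‖E S x‖ * ‖w‖) := by gcongr
        _ = _ := by ring
  rcases eq_or_lt_of_le (norm_nonneg w) with h | h
  · rw [← h]
    positivity
  · nlinarith

theorem apply_comm (hS : MeasurableSet S) (hSr : S ⊆ Metric.closedBall z r) (x : A.domain) :
    A ⟨E S x, hE.apply_mem_domain hS hSr x⟩ = E S (A x) := by
  refine ext_inner_left ℂ fun y => ?_
  rw [hE.inner_eq, ← E.inner_apply_left hS, hE.inner_eq, E.measure_apply_left hS,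
    E.measure_apply_right hS]

end ResolutionOfIdentity.IsResolutionOf

/-! ### Openness of the resolvent set. -/

namespace UnboundedOp

/-- From `(w - A) R = 1 + (w - z) R` with `R` the resolvent at `z`: the right side is invertible for
`w` near `z`, and `R (1 + (w - z) R)⁻¹` is the resolvent at `w`. This makes the spectrum a Borel
set. -/
theorem isOpen_resolventSet (A : K →ₗ.[ℂ] K) : IsOpen (resolventSet A) := by
  rw [isOpen_iff_mem_nhds]
  rintro z ⟨R, hR, hR'⟩
  have hc : ContinuousAt (fun w : ℂ => 1 + (w - z) • R) z := by fun_prop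
  have hu : ∀ᶠ w in 𝓝 z, IsUnit (1 + (w - z) • R) := by
    refine hc.eventually_mem (Units.isOpen.mem_nhds ?_)
    simp
  filter_upwards [hu] with w hw
  obtain ⟨U, hU⟩ := hw
  have hU1 : ∀ x, ((↑U⁻¹ : K →L[ℂ] K) x) + (w - z) • R ((↑U⁻¹ : K →L[ℂ] K) x) = x := fun x => by
    have := congrArg (fun T : K →L[ℂ] K => T x) U.mul_inv
    rw [hU] at this
    simpa using this
  have hU2 : ∀ x, (↑U⁻¹ : K →L[ℂ] K) (x + (w - z) • R x) = x := fun x => by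
    have := congrArg (fun T : K →L[ℂ] K => T x) U.inv_mul
    rw [hU] at this
    simpa using this
  refine ⟨R * ↑U⁻¹, fun x => ?_, fun x => ?_⟩
  · obtain ⟨h, h'⟩ := hR ((↑U⁻¹ : K →L[ℂ] K) x)
    refine ⟨h, ?_⟩
    change w • R ((↑U⁻¹ : K →L[ℂ] K) x) - A ⟨R ((↑U⁻¹ : K →L[ℂ] K) x), h⟩ = x
    have h1 := hU1 x
    nth_rw 1 [← h'] at h1
    refine Eq.trans ?_ h1
    rw [sub_smul]
    abel
  · change R ((↑U⁻¹ : K →L[ℂ] K) (w • (x : K) - A x)) = x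
    have h1 := hU2 (z • (x : K) - A x)
    rw [hR' x] at h1
    have h2 : w • (x : K) - A x = z • (x : K) - A x + (w - z) • (x : K) := by
      rw [sub_smul]
      abel
    rw [h2, h1, hR' x]

theorem isClosed_spectrum (A : K →ₗ.[ℂ] K) : IsClosed (spectrum A) :=
  (isOpen_resolventSet A).isClosed_compl

end UnboundedOp

/-! ### Support of the resolution of identity, and the gap. -/

namespace ResolutionOfIdentity.IsResolutionOf

variable {E : ResolutionOfIdentity K} {A : K →ₗ.[ℂ] K} (hE : E.IsResolutionOf A)

include hE

open UnboundedOp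

/-- The resolution of identity of an operator is supported on the spectrum. -/
theorem apply_resolventSet : E (resolventSet A) = 0 := by
  have hm := (isOpen_resolventSet A).measurableSet
  refine E.apply_eq_zero_of_locally hm fun z hz => ?_
  obtain ⟨R, -, hR⟩ := hz
  have hpos : 0 < ‖R‖ + 1 := by positivity
  -- With this radius, `E_S x = R (z - A) E_S x` gives `‖E_S x‖ ≤ ‖E_S x‖ / 2`. The `+ 1` covers `R
  -- = 0`.
  refine ⟨(2 * (‖R‖ + 1))⁻¹, by positivity, ?_⟩
  ext x
  set S := Metric.closedBall z (2 * (‖R‖ + 1))⁻¹ ∩ resolventSet A with hSdef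
  have hS : MeasurableSet S := Metric.isClosed_closedBall.measurableSet.inter hm
  have hSr : S ⊆ Metric.closedBall z (2 * (‖R‖ + 1))⁻¹ := Set.inter_subset_left
  have h1 := hE.norm_apply_sub_le hS hSr (by positivity) x
  have h2 := hR ⟨E S x, hE.apply_mem_domain hS hSr x⟩
  have h3 : ‖E S x‖ ≤ ‖R‖ * ((2 * (‖R‖ + 1))⁻¹ * ‖E S x‖) := by
    calc ‖E S x‖ = ‖R (z • E S x - A ⟨E S x, hE.apply_mem_domain hS hSr x⟩)‖ := by rw [h2]
      _ ≤ ‖R‖ * ‖z • E S x - A ⟨E S x, hE.apply_mem_domain hS hSr x⟩‖ := R.le_opNorm _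
      _ ≤ _ := by
        rw [norm_sub_rev]
        gcongr
  have h4 : ‖R‖ * (2 * (‖R‖ + 1))⁻¹ ≤ 1 / 2 := by
    rw [← div_eq_mul_inv, div_le_div_iff₀ (by positivity) two_pos]
    linarith
  have h5 : ‖E S x‖ ≤ 0 := by
    rw [← mul_assoc] at h3
    nlinarith [norm_nonneg (E S x)]
  simpa using h5

/-- Under a spectral gap there is no spectral mass in `{Re γ < γ₁} \ {0}`. -/
theorem apply_gap {γ₁ : ℝ} (hgap : HasSpectralGap A γ₁) :
    E ({γ : ℂ | γ.re < γ₁} \ {0}) = 0 := by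
  have hm := (isOpen_resolventSet A).measurableSet
  have hIm : MeasurableSet ({γ : ℂ | γ.re = 0} \ {0}) :=
    (measurableSet_eq_fun Complex.measurable_re measurable_const).diff (measurableSet_singleton 0)
  have hT : MeasurableSet ({γ : ℂ | γ.re < γ₁} \ {0}) :=
    (measurableSet_lt Complex.measurable_re measurable_const).diff (measurableSet_singleton 0)
  refine E.apply_eq_zero_mono hT (hIm.union hm) ?_
    (E.apply_union_eq_zero hIm hm ?_ hE.apply_resolventSet)
  · rintro γ ⟨h1, h2⟩
    by_cases hγ : γ ∈ resolventSet A
    · exact Or.inr hγ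
    · refine Or.inl ⟨?_, h2⟩
      have h3 : γ ∈ spectrum A := hγ
      rcases eq_or_lt_of_le (hgap.re_nonneg γ h3) with h | h
      · exact h.symm
      · exact absurd h1 (not_lt.2 (hgap.isGLB_spectrum.1 ⟨γ, h3, h, rfl⟩))
  -- What remains are the nonzero imaginary points, which the spectral infimum does not see; the
  -- Rayleigh infimum excludes them.
  refine E.apply_eq_zero_of_locally hIm fun z hz => ?_
  obtain ⟨hz, hz0⟩ := hz
  have hz' : 0 < ‖z‖ := norm_pos_iff.2 hz0
  have hpos := hgap.pos
  -- The bound `‖z‖ / 2` forces `E_S h = 0` for `h ∈ ker A`, so `E_S x` is admissible in the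
  -- Rayleigh quotient. As `Re z = 0`, that quotient is at most `ε ≤ γ₁ / 2`, a contradiction.
  set ε := min (γ₁ / 2) (‖z‖ / 2) with hε
  have hε0 : 0 < ε := lt_min (by positivity) (by positivity)
  have hε1 : ε ≤ γ₁ / 2 := min_le_left _ _
  have hε2 : ε ≤ ‖z‖ / 2 := min_le_right _ _
  refine ⟨ε, hε0, ?_⟩
  set S := Metric.closedBall z ε ∩ ({γ : ℂ | γ.re = 0} \ {0}) with hSdef
  have hS : MeasurableSet S := Metric.isClosed_closedBall.measurableSet.inter hIm
  have hSr : S ⊆ Metric.closedBall z ε := Set.inter_subset_left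
  ext x
  by_contra hv
  have hv0 : 0 < ‖E S x‖ := norm_pos_iff.2 hv
  have horth : ∀ h : A.domain, A h = 0 → inner ℂ (h : K) (E S x) = 0 := fun h hh => by
    rw [← E.inner_apply_left hS]
    have h1 := hE.norm_apply_sub_le hS hSr hε0.le (h : K)
    rw [hE.apply_comm hS hSr h, hh, map_zero, zero_sub, norm_neg, norm_smul] at h1
    have h2 : ‖E S (h : K)‖ ≤ 0 := by
      nlinarith [norm_nonneg (E S (h : K))]
    rw [norm_le_zero_iff.1 h2, inner_zero_left]
  have h1 := hgap.isGLB_rayleigh.1 ⟨⟨E S x, hE.apply_mem_domain hS hSr x⟩, hv, horth, rfl⟩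
  have h2 := hE.norm_apply_sub_le hS hSr hε0.le x
  rw [le_div_iff₀ (by positivity)] at h1
  have h3 : (inner ℂ (E S x) (A ⟨E S x, hE.apply_mem_domain hS hSr x⟩)).re =
      (inner ℂ (E S x) (A ⟨E S x, hE.apply_mem_domain hS hSr x⟩ - z • E S x)).re := by
    have hz1 : z.re = 0 := hz
    rw [inner_sub_right, inner_smul_right, inner_self_eq_norm_sq_to_K, Complex.sub_re]
    simp only [Complex.coe_algebraMap, ← Complex.ofReal_pow, Complex.re_mul_ofReal,
      hz1, zero_mul, sub_zero]
  have h4 := (Complex.re_le_norm _).trans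
    (norm_inner_le_norm (𝕜 := ℂ) (E S x)
      (A ⟨E S x, hE.apply_mem_domain hS hSr x⟩ - z • E S x))
  simp only at h1
  rw [h3] at h1
  nlinarith [mul_le_mul_of_nonneg_left h2 hv0.le, mul_pos hv0 hv0]

end ResolutionOfIdentity.IsResolutionOf

/-! ### The semigroup as a spectral integral -/

namespace ContractionSemigroup

theorem add_apply (Q : ContractionSemigroup K) (s t : ℝ≥0) (x : K) : Q (s + t) x = Q s (Q t x) := by
  rw [Q.map_add']
  rfl

theorem zero_apply (Q : ContractionSemigroup K) (x : K) : Q 0 x = x := by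
  rw [Q.map_zero']
  rfl

theorem norm_apply_le (Q : ContractionSemigroup K) (t : ℝ≥0) (x : K) : ‖Q t x‖ ≤ ‖x‖ := by
  simpa using (Q t).le_of_opNorm_le (Q.norm_le' t) x

/-- Subtraction in `ℝ≥0` truncates, so `(s - t) + (t - s)` is `|s - t|`. Factoring out the
contraction at the smaller time reduces continuity of orbits to continuity at `0`. -/
theorem norm_apply_sub_apply_le (Q : ContractionSemigroup K) (s t : ℝ≥0) (x : K) :
    ‖Q s x - Q t x‖ ≤ ‖Q ((s - t) + (t - s)) x - x‖ := by
  rcases le_total s t with h | h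
  · rw [tsub_eq_zero_of_le h, zero_add]
    have h1 : Q t x = Q s (Q (t - s) x) := by rw [← Q.add_apply, add_tsub_cancel_of_le h]
    rw [h1, ← map_sub, norm_sub_rev (Q (t - s) x)]
    exact Q.norm_apply_le _ _
  · rw [tsub_eq_zero_of_le h, add_zero]
    have h1 : Q s x = Q t (Q (s - t) x) := by rw [← Q.add_apply, add_tsub_cancel_of_le h]
    rw [h1, ← map_sub]
    exact Q.norm_apply_le _ _

theorem continuous_apply (Q : ContractionSemigroup K) (x : K) : Continuous fun t => Q t x := by
  rw [continuous_iff_continuousAt]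
  intro t
  rw [ContinuousAt, tendsto_iff_norm_sub_tendsto_zero]
  have h1 : Tendsto (fun s : ℝ≥0 => (s - t) + (t - s)) (𝓝 t) (𝓝 0) := by
    have : Continuous fun s : ℝ≥0 => (s - t) + (t - s) := by fun_prop
    simpa using this.tendsto t
  have h2 : Tendsto (fun s : ℝ≥0 => ‖Q ((s - t) + (t - s)) x - x‖) (𝓝 t) (𝓝 0) :=
    tendsto_iff_norm_sub_tendsto_zero.1 ((Q.tendsto' x).comp h1)
  exact squeeze_zero (fun _ => norm_nonneg _) (fun s => Q.norm_apply_sub_apply_le s t x) h2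

theorem continuous_apply₂ (Q : ContractionSemigroup K) {Y : Type*} [TopologicalSpace Y]
    {τ : Y → ℝ≥0} {w : Y → K} (hτ : Continuous τ) (hw : Continuous w) :
    Continuous fun s => Q (τ s) (w s) := by
  rw [continuous_iff_continuousAt]
  intro s
  rw [ContinuousAt, tendsto_iff_norm_sub_tendsto_zero]
  have h1 : Tendsto (fun r => ‖w r - w s‖ + ‖Q (τ r) (w s) - Q (τ s) (w s)‖) (𝓝 s) (𝓝 0) := by
    have h2 := tendsto_iff_norm_sub_tendsto_zero.1 (hw.tendsto s)
    have h3 := tendsto_iff_norm_sub_tendsto_zero.1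
      (((Q.continuous_apply (w s)).comp hτ).tendsto s)
    simpa using h2.add h3
  refine squeeze_zero (fun _ => norm_nonneg _) (fun r => ?_) h1
  have h4 : Q (τ r) (w r) - Q (τ s) (w s) =
      Q (τ r) (w r - w s) + (Q (τ r) (w s) - Q (τ s) (w s)) := by
    rw [map_sub]
    abel
  rw [h4]
  exact (norm_add_le _ _).trans (add_le_add_left (Q.norm_apply_le _ _) _)

theorem HasGen.hasDerivWithinAt {Q : ContractionSemigroup K} {x u : K} (h : Q.HasGen x u) (s : ℝ) :
    HasDerivWithinAt (fun r : ℝ => Q (r - s).toNNReal x) (-u) (Set.Ici s) s := by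
  rw [← hasDerivWithinAt_Ioi_iff_Ici, hasDerivWithinAt_iff_tendsto_slope' Set.self_notMem_Ioi]
  have h1 : Tendsto (fun r : ℝ => (r - s).toNNReal) (𝓝[>] s) (𝓝[>] 0) := by
    refine tendsto_nhdsWithin_iff.2 ⟨?_, ?_⟩
    · have : Continuous fun r : ℝ => (r - s).toNNReal := by fun_prop
      have h2 := this.tendsto s
      rw [sub_self, Real.toNNReal_zero] at h2
      exact h2.mono_left nhdsWithin_le_nhds
    · filter_upwards [self_mem_nhdsWithin] with r hr
      exact Real.toNNReal_pos.2 (sub_pos.2 hr)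
  refine (Tendsto.neg (h.comp h1)).congr' ?_
  filter_upwards [self_mem_nhdsWithin] with r hr
  have hr' : 0 ≤ r - s := (sub_pos.2 hr).le
  simp only [Function.comp_apply, slope_def_module, Real.coe_toNNReal _ hr', sub_self,
    Real.toNNReal_zero, Q.zero_apply, Complex.coe_smul]
  rw [← smul_neg, neg_sub]

/-- Uniqueness for the abstract Cauchy problem `w' = - A w`. -/
theorem apply_eq_of_hasDerivAt (Q : ContractionSemigroup K) {w u : ℝ → K}
    (hw : ∀ s, HasDerivAt w (-u s) s) (hu : ∀ s, Q.HasGen (w s) (u s)) (t : ℝ≥0) :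
    Q t (w 0) = w t := by
  have hwc : Continuous w := continuous_iff_continuousAt.2 fun s => (hw s).continuousAt
  -- The path `s ↦ Q_{t-s} w(s)` joins `Q_t w(0)` to `w(t)`; it is constant because its right
  -- derivative vanishes.
  have hcont : ContinuousOn (fun s : ℝ => Q ((t : ℝ) - s).toNNReal (w s)) (Set.Icc 0 (t : ℝ)) :=
    (Q.continuous_apply₂ (by fun_prop) hwc).continuousOn
  have hderiv : ∀ s ∈ Set.Ico 0 (t : ℝ),
      HasDerivWithinAt (fun s : ℝ => Q ((t : ℝ) - s).toNNReal (w s)) 0 (Set.Ici s) s := by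
    rintro s ⟨-, hst⟩
    -- Both `w(r)` and `Q_{r-s} w(s)` have right derivative `-u(s)` at `s`, so they differ by `o(r -
    -- s)`. The increment of the path is the contraction `Q_{t-r}` applied to this difference.
    have h1 := (hw s).hasDerivWithinAt (s := Set.Ici s) |>.sub ((hu s).hasDerivWithinAt s)
    rw [sub_self, hasDerivWithinAt_iff_isLittleO] at h1
    rw [hasDerivWithinAt_iff_isLittleO]
    refine Asymptotics.IsBigO.trans_isLittleO (Asymptotics.IsBigO.of_bound 1 ?_) h1
    filter_upwards [self_mem_nhdsWithin, nhdsWithin_le_nhds (Iio_mem_nhds hst)] with r hr hrt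
    have hr1 : 0 ≤ r - s := sub_nonneg.2 hr
    have hr2 : 0 ≤ (t : ℝ) - r := sub_nonneg.2 (le_of_lt hrt)
    have e : ((t : ℝ) - s).toNNReal = ((t : ℝ) - r).toNNReal + (r - s).toNNReal := by
      rw [← Real.toNNReal_add hr2 hr1]
      congr 1
      ring
    simp only [smul_zero, sub_zero, sub_self, Real.toNNReal_zero, Q.zero_apply, one_mul,
      Pi.sub_apply]
    rw [e, Q.add_apply, ← map_sub]
    exact Q.norm_apply_le _ _
  have h := constant_of_has_deriv_right_zero hcont hderiv t ⟨t.2, le_rfl⟩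
  simp only [sub_self, Real.toNNReal_zero, Q.zero_apply, sub_zero, Real.toNNReal_coe] at h
  exact h.symm

theorem hasGen_gen (Q : ContractionSemigroup K) (x : Q.gen.domain) : Q.HasGen x (Q.gen x) :=
  x.2.choose_spec

end ContractionSemigroup

namespace ResolutionOfIdentity.IsResolutionOf

open UnboundedOp

/-! ### The bounded pieces `A E_S` and their exponentials. -/

section BoundedPart

variable {E : ResolutionOfIdentity K} {A : K →ₗ.[ℂ] K} (hE : E.IsResolutionOf A)
  {S : Set ℂ} {r : ℝ} (hS : MeasurableSet S) (hSr : S ⊆ Metric.closedBall 0 r) (hr : 0 ≤ r)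

/-- The bounded operator `A E_S`, for `S` bounded. -/
def boundedPart : K →L[ℂ] K :=
  LinearMap.mkContinuous
    { toFun := fun x => A ⟨E S x, hE.apply_mem_domain hS hSr x⟩
      map_add' := fun x y => by
        rw [← A.map_add]
        congr 1
        simp
      map_smul' := fun c x => by
        rw [RingHom.id_apply, ← A.map_smul]
        congr 1
        simp } r
    (fun x => by
      have h := hE.norm_apply_sub_le hS hSr hr x
      rw [zero_smul, sub_zero] at h
      exact h.trans (mul_le_mul_of_nonneg_left (E.norm_apply_le S x) hr))

theorem boundedPart_apply (x : K) :
    hE.boundedPart hS hSr hr x = A ⟨E S x, hE.apply_mem_domain hS hSr x⟩ := rfl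

theorem inner_boundedPart (x y : K) :
    inner ℂ y (hE.boundedPart hS hSr hr x) =
      ∫ᵛ γ in S, γ ∂[ContinuousLinearMap.mul ℝ ℂ; E.measure x y] := by
  have h := hE.inner_apply_sub hS hSr 0 x y
  rw [boundedPart_apply]
  simpa using h

theorem boundedPart_comp (x : K) :
    hE.boundedPart hS hSr hr (E S x) = hE.boundedPart hS hSr hr x := by
  simp only [boundedPart_apply, E.apply_self_apply hS]

theorem comp_boundedPart (x : K) :
    E S (hE.boundedPart hS hSr hr x) = hE.boundedPart hS hSr hr x := by
  refine ext_inner_left ℂ fun y => ?_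
  rw [← E.inner_apply_left hS, inner_boundedPart, inner_boundedPart, E.measure_apply_right hS,
    VectorMeasure.restrict_restrict _ hS hS, Set.inter_self]

/-- The measure of `A E_S x` has density `γ 1_S(γ)` with respect to that of `x`. Each factor of `A
E_S` thus contributes one factor `γ`, which drives the induction on powers. -/
theorem integral_measure_boundedPart (x y : K) {φ : ℂ → ℂ} (hφ : Measurable φ) {C : ℝ}
    (hC : ∀ γ, ‖φ γ‖ ≤ C) :
    ∫ᵛ γ, φ γ ∂[ContinuousLinearMap.mul ℝ ℂ; E.measure (hE.boundedPart hS hSr hr x) y] =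
      ∫ᵛ γ, φ γ * S.indicator (fun γ => γ) γ ∂[ContinuousLinearMap.mul ℝ ℂ; E.measure x y] := by
  refine integral_of_eq_density (measurable_id'.indicator hS) (R := r) (fun γ => ?_)
    (fun T hT => ?_) hφ hC
  · by_cases hγ : γ ∈ S
    · simpa [hγ] using hSr hγ
    · simpa [hγ] using hr
  · rw [E.measure_apply, ← E.inner_apply_left hT, inner_boundedPart, E.measure_apply_right hT,
      VectorMeasure.integral_indicator hS]

theorem inner_boundedPart_pow (k : ℕ) (x y : K) :
    inner ℂ y ((hE.boundedPart hS hSr hr ^ k) (E S x)) =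
      ∫ᵛ γ in S, γ ^ k ∂[ContinuousLinearMap.mul ℝ ℂ; E.measure x y] := by
  induction k generalizing x with
  | zero =>
    simp only [pow_zero]
    rw [VectorMeasure.setIntegral_const]
    simp [E.measure_apply]
  | succ k ih =>
    rw [pow_succ, mul_apply_eq_comp, boundedPart_comp,
      ← comp_boundedPart hE hS hSr hr x, ih, ← VectorMeasure.integral_indicator hS,
      ← VectorMeasure.integral_indicator hS,
      hE.integral_measure_boundedPart hS hSr hr x y
        ((measurable_id'.pow_const k).indicator hS) (C := r ^ k)]
    · congr 1
      ext γ
      by_cases hγ : γ ∈ S <;> simp [hγ, pow_succ]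
    · intro γ
      by_cases hγ : γ ∈ S
      · have h1 : ‖γ‖ ≤ r := by simpa using hSr hγ
        simpa [hγ] using pow_le_pow_left₀ (norm_nonneg γ) h1 k
      · simpa [hγ] using pow_nonneg hr k

/-- The exponential series is integrated term by term, dominated on `S` by `(|t| r)^k / k!`. -/
theorem inner_exp_boundedPart (t : ℝ) (x y : K) :
    inner ℂ y (NormedSpace.exp (t • -hE.boundedPart hS hSr hr) (E S x)) =
      ∫ᵛ γ in S, Complex.exp (-(γ * (t : ℂ)))
        ∂[ContinuousLinearMap.mul ℝ ℂ; E.measure x y] := by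
  set B := hE.boundedPart hS hSr hr with hB
  have h1 := NormedSpace.exp_series_hasSum_exp' (𝕂 := ℝ) (t • -B)
  have h2 := ((innerSL ℂ y) ∘L ContinuousLinearMap.apply ℂ K (E S x)).hasSum h1
  have h3 : HasSum
      (fun k : ℕ => ∫ᵛ γ in S, ((k.factorial : ℝ)⁻¹ * (-t) ^ k) • γ ^ k
        ∂[ContinuousLinearMap.mul ℝ ℂ; E.measure x y])
      (∫ᵛ γ in S, Complex.exp (-(γ * (t : ℂ)))
        ∂[ContinuousLinearMap.mul ℝ ℂ; E.measure x y]) := by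
    have hs : Summable fun k : ℕ => (k.factorial : ℝ)⁻¹ * (|t| * r) ^ k := by
      simpa [div_eq_inv_mul] using Real.summable_pow_div_factorial (|t| * r)
    refine VectorMeasure.hasSum_integral_of_dominated_convergence
      (fun k _ => (k.factorial : ℝ)⁻¹ * (|t| * r) ^ k)
      (fun k => Measurable.aestronglyMeasurable (by fun_prop)) (fun k => ?_)
      (Eventually.of_forall fun _ => hs) (integrable_const _) (Eventually.of_forall fun γ => ?_)
    · rw [VectorMeasure.variation_restrict hS]
      refine (ae_restrict_iff' hS).2 (Eventually.of_forall fun γ hγ => ?_)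
      have hγ' : ‖γ‖ ≤ r := by simpa using hSr hγ
      rw [norm_smul, norm_mul, norm_pow, norm_pow, norm_inv, norm_neg, Real.norm_eq_abs t,
        Real.norm_of_nonneg (Nat.cast_nonneg _), mul_assoc, ← mul_pow]
      gcongr
    · have h4 := NormedSpace.expSeries_div_hasSum_exp (𝔸 := ℂ) (-(γ * (t : ℂ)))
      rw [← Complex.exp_eq_exp_ℂ] at h4
      refine (congrArg (fun f : ℕ → ℂ => HasSum f (Complex.exp (-(γ * (t : ℂ)))))
        (funext fun k => ?_)).mpr h4
      rw [Complex.real_smul]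
      push_cast
      rw [div_eq_inv_mul, mul_assoc, ← mul_pow]
      congr 2
      ring
  refine h2.unique ?_
  refine (congrArg (fun f : ℕ → ℂ => HasSum f _) (funext fun k => ?_)).mpr h3
  rw [VectorMeasure.integral_fun_smul, ← hE.inner_boundedPart_pow hS hSr hr k x y, ← hB]
  simp only [Function.comp_apply, ContinuousLinearMap.coe_comp, ContinuousLinearMap.apply_apply,
    innerSL_apply_apply]
  have h5 : (t • -B) ^ k = ((-t) ^ k) • B ^ k := by
    rw [smul_neg, ← neg_smul, smul_pow]
  rw [h5, smul_smul]
  simp only [smul_apply]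
  rw [← Complex.coe_smul, inner_smul_right, Complex.real_smul]

end BoundedPart

variable {E : ResolutionOfIdentity K} {Q : ContractionSemigroup K} (hE : E.IsResolutionOf Q.gen)
  {S : Set ℂ} {r : ℝ} (hS : MeasurableSet S) (hSr : S ⊆ Metric.closedBall 0 r) (hr : 0 ≤ r)

theorem semigroup_apply_eq_exp (t : ℝ≥0) (x : K) :
    Q t (E S x) = NormedSpace.exp ((t : ℝ) • -hE.boundedPart hS hSr hr) (E S x) := by
  set B := hE.boundedPart hS hSr hr with hB
  have hcomm : ∀ s : ℝ, Commute (E S) (NormedSpace.exp (s • -B)) := fun s => by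
    refine Commute.exp_right ?_
    refine Commute.smul_right (Commute.neg_right ?_) s
    ext v
    change E S (B v) = B (E S v)
    rw [hB, hE.comp_boundedPart, hE.boundedPart_comp]
  have hw : ∀ s : ℝ, HasDerivAt (fun s : ℝ => NormedSpace.exp (s • -B) (E S x))
      (-B (NormedSpace.exp (s • -B) (E S x))) s := fun s => by
    have h := hasDerivAt_exp_smul_const' (𝕂 := ℝ) (-B) s
    have h' := ((ContinuousLinearMap.apply ℂ K (E S x)).restrictScalars ℝ).hasFDerivAt.comp_hasDerivAt
      s h
    simpa [Function.comp_def] using h'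
  have hu : ∀ s : ℝ, Q.HasGen (NormedSpace.exp (s • -B) (E S x))
      (B (NormedSpace.exp (s • -B) (E S x))) := fun s => by
    -- The exponential commutes with `E_S`, so the trajectory stays in `ran E_S`, inside the domain,
    -- where the generator acts as `B`.
    have h1 : E S (NormedSpace.exp (s • -B) (E S x)) = NormedSpace.exp (s • -B) (E S x) := by
      have h := congrArg (fun T : K →L[ℂ] K => T (E S x)) (hcomm s).eq
      simp only [mul_apply_eq_comp, E.apply_self_apply hS] at h
      exact h
    have h2 := Q.hasGen_gen ⟨_, hE.apply_mem_domain hS hSr (NormedSpace.exp (s • -B) (E S x))⟩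
    rw [← hE.boundedPart_apply hS hSr hr] at h2
    simp only [h1] at h2
    exact h2
  have h := Q.apply_eq_of_hasDerivAt hw hu t
  simpa using h

include hE in
/-- `Q_t = ∫ e^{-γ t} dE_γ`, in the weak sense. -/
theorem inner_semigroup_apply (hre : ∀ γ ∈ spectrum Q.gen, 0 ≤ γ.re) (t : ℝ≥0) (x y : K) :
    inner ℂ y (Q t x) =
      ∫ᵛ γ in spectrum Q.gen, Complex.exp (-(γ * ((t : ℝ) : ℂ)))
        ∂[ContinuousLinearMap.mul ℝ ℂ; E.measure x y] := by
  have hσ := (isClosed_spectrum Q.gen).measurableSet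
  have hσ0 : E (spectrum Q.gen)ᶜ = 0 := by
    rw [UnboundedOp.spectrum, compl_compl]
    exact hE.apply_resolventSet
  have hS : ∀ n : ℕ, MeasurableSet (Metric.closedBall (0 : ℂ) n) := fun n =>
    Metric.isClosed_closedBall.measurableSet
  have h1 : ∀ n : ℕ, inner ℂ y (Q t (E (Metric.closedBall (0 : ℂ) n) x)) =
      ∫ᵛ γ in spectrum Q.gen, (Metric.closedBall (0 : ℂ) n).indicator
        (fun γ => Complex.exp (-(γ * ((t : ℝ) : ℂ)))) γ
        ∂[ContinuousLinearMap.mul ℝ ℂ; E.measure x y] := fun n => by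
    rw [hE.semigroup_apply_eq_exp (hS n) subset_rfl (Nat.cast_nonneg n),
      hE.inner_exp_boundedPart (hS n) subset_rfl (Nat.cast_nonneg n),
      VectorMeasure.integral_indicator (hS n), ← E.measure_eq_restrict hσ hσ0]
  have h2 : Tendsto (fun n : ℕ => inner ℂ y (Q t (E (Metric.closedBall (0 : ℂ) n) x))) atTop
      (𝓝 (inner ℂ y (Q t x))) := by
    -- Moving `Q_t` to the other side as an adjoint turns the limit into continuity from below of
    -- one complex measure on growing balls.
    have h3 := VectorMeasure.tendsto_vectorMeasure_iUnion_atTop_nat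
      (v := E.measure x (ContinuousLinearMap.adjoint (Q t) y))
      (s := fun n : ℕ => Metric.closedBall (0 : ℂ) n)
      (fun a b hab => Metric.closedBall_subset_closedBall (by exact_mod_cast hab)) hS
    rw [Metric.iUnion_closedBall_nat, E.measure_apply, E.univ'] at h3
    simpa [Function.comp_def, E.measure_apply, ContinuousLinearMap.adjoint_inner_left] using h3
  refine tendsto_nhds_unique h2 ?_
  simp only [h1]
  refine VectorMeasure.tendsto_integral_filter_of_norm_le_const
    (Eventually.of_forall fun n =>
      (Measurable.indicator (by fun_prop) (hS n)).aestronglyMeasurable)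
    ⟨1, Eventually.of_forall fun n => ?_⟩ (Eventually.of_forall fun γ => ?_)
  · rw [VectorMeasure.variation_restrict hσ]
    refine (ae_restrict_iff' hσ).2 (Eventually.of_forall fun γ hγ => ?_)
    refine (norm_indicator_le_norm_self _ _).trans ?_
    rw [Complex.norm_exp, Real.exp_le_one_iff, Complex.neg_re, Complex.re_mul_ofReal,
      neg_nonpos]
    exact mul_nonneg (hre γ hγ) t.2
  · obtain ⟨N, hN⟩ := exists_nat_ge ‖γ‖
    refine tendsto_const_nhds.congr' ?_
    filter_upwards [eventually_ge_atTop N] with n hn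
    have hmem : γ ∈ Metric.closedBall (0 : ℂ) n := by
      have : (N : ℝ) ≤ n := by exact_mod_cast hn
      simpa using hN.trans this
    rw [Set.indicator_of_mem hmem]

end ResolutionOfIdentity.IsResolutionOf

/-! ### Equilibria of intertwined semigroups -/

namespace ContractionSemigroup

/-- Fixed vectors of a contraction are fixed by its adjoint: expanding `‖P_t* v - v‖²` with `⟪P_t*
v, v⟫ = ‖v‖²` and `‖P_t* v‖ ≤ ‖v‖` gives at most `0`. -/
theorem adjoint_apply_of_mem_invariant (P : ContractionSemigroup H) {v : H} (hv : v ∈ P.invariant)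
    (t : ℝ≥0) : ContinuousLinearMap.adjoint (P t) v = v := by
  have h1 : P t v = v := hv t
  have h2 : ‖ContinuousLinearMap.adjoint (P t) v‖ ≤ ‖v‖ := by
    have h3 : ‖ContinuousLinearMap.adjoint (P t)‖ ≤ 1 := by
      rw [LinearIsometryEquiv.norm_map]
      exact P.norm_le' t
    simpa using (ContinuousLinearMap.adjoint (P t)).le_of_opNorm_le h3 v
  have h4 := norm_sub_sq (𝕜 := ℂ) (ContinuousLinearMap.adjoint (P t) v) v
  rw [ContinuousLinearMap.adjoint_inner_left, h1, inner_self_eq_norm_sq] at h4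
  have h5 : ‖ContinuousLinearMap.adjoint (P t) v - v‖ ^ 2 ≤ 0 := by
    nlinarith [norm_nonneg v, norm_nonneg (ContinuousLinearMap.adjoint (P t) v)]
  have h6 := pow_eq_zero_iff two_ne_zero |>.1 (le_antisymm h5 (sq_nonneg _))
  exact sub_eq_zero.1 (norm_eq_zero.1 h6)

end ContractionSemigroup

theorem norm_exp_neg_mul (γ : ℂ) (t : ℝ≥0) :
    ‖Complex.exp (-(γ * ((t : ℝ) : ℂ)))‖ = Real.exp (-(γ.re * t)) := by
  rw [Complex.norm_exp, Complex.neg_re, Complex.re_mul_ofReal]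

namespace ResolutionOfIdentity.IsResolutionOf

open UnboundedOp

variable {E : ResolutionOfIdentity K} {Q : ContractionSemigroup K} (hE : E.IsResolutionOf Q.gen)

include hE

theorem semigroup_apply_singleton_zero (t : ℝ≥0) (x : K) : Q t (E {0} x) = E {0} x := by
  have hS : MeasurableSet ({0} : Set ℂ) := measurableSet_singleton 0
  -- Radius zero makes the norm bound on `A E_{0}` vanish.
  have hSr : ({0} : Set ℂ) ⊆ Metric.closedBall 0 0 := by simp
  rw [hE.semigroup_apply_eq_exp hS hSr le_rfl]
  have h0 : hE.boundedPart hS hSr le_rfl = 0 := by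
    ext v
    have h := hE.norm_apply_sub_le hS hSr le_rfl v
    rw [zero_smul, sub_zero, zero_mul] at h
    exact norm_le_zero_iff.1 h
  rw [h0]
  simp

theorem variation_gap {γ₁ : ℝ} (hgap : HasSpectralGap Q.gen γ₁) (x y : K) :
    (E.measure (E {0}ᶜ x) y).variation {γ : ℂ | γ.re < γ₁} = 0 := by
  have h0 : MeasurableSet ({0}ᶜ : Set ℂ) := (measurableSet_singleton 0).compl
  have hm : MeasurableSet {γ : ℂ | γ.re < γ₁} :=
    measurableSet_lt Complex.measurable_re measurable_const
  rw [VectorMeasure.variation_apply_eq_zero hm]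
  intro T hT hTm
  rw [E.measure_apply, E.apply_apply hTm h0]
  have h1 := E.apply_eq_zero_mono (hTm.inter h0) (hm.diff (measurableSet_singleton 0))
    (Set.inter_subset_inter_left _ hT) (hE.apply_gap hgap)
  rw [h1]
  simp

theorem ae_re_ge {γ₁ : ℝ} (hgap : HasSpectralGap Q.gen γ₁) (x y : K) :
    ∀ᵐ γ ∂(E.measure (E {0}ᶜ x) y).variation, γ₁ ≤ γ.re := by
  rw [ae_iff]
  simpa using hE.variation_gap hgap x y

theorem norm_inner_semigroup_le {γ₁ : ℝ} (hgap : HasSpectralGap Q.gen γ₁) (t : ℝ≥0) (x y : K) :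
    ‖inner ℂ y (Q t (E {0}ᶜ x))‖ ≤
      Real.exp (-(γ₁ * t)) * (E.measure (E {0}ᶜ x) y).variation.real Set.univ := by
  rw [hE.inner_semigroup_apply hgap.re_nonneg]
  have hσ := (isClosed_spectrum Q.gen).measurableSet
  have h := VectorMeasure.norm_setIntegral_le_of_norm_le_const_ae
    (μ := E.measure (E {0}ᶜ x) y) (s := spectrum Q.gen) (B := ContinuousLinearMap.mul ℝ ℂ)
    (f := fun γ => Complex.exp (-(γ * ((t : ℝ) : ℂ)))) (C := Real.exp (-(γ₁ * t))) (by
      refine ae_restrict_of_ae ?_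
      filter_upwards [hE.ae_re_ge hgap x y] with γ hγ
      rw [norm_exp_neg_mul]
      gcongr)
  refine h.trans ?_
  have h1 : ‖ContinuousLinearMap.mul ℝ ℂ‖ ≤ 1 := ContinuousLinearMap.opNorm_mul_le ℝ ℂ
  calc Real.exp (-(γ₁ * t)) * ‖ContinuousLinearMap.mul ℝ ℂ‖ *
        (E.measure (E {0}ᶜ x) y).variation.real (spectrum Q.gen)
      ≤ Real.exp (-(γ₁ * t)) * 1 * (E.measure (E {0}ᶜ x) y).variation.real Set.univ := by
        gcongr
        · finiteness
        · exact Set.subset_univ _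
    _ = _ := by rw [mul_one]

/-- The mass of `E_{0}ᶜ x` sits in `{Re γ ≥ γ₁}`, where `|e^{-γt}| ≤ e^{-γ₁t}`. Only the limit
matters: it identifies the equilibrium. -/
theorem tendsto_inner_semigroup {γ₁ : ℝ} (hgap : HasSpectralGap Q.gen γ₁) (x y : K) :
    Tendsto (fun t : ℝ≥0 => inner ℂ y (Q t (E {0}ᶜ x))) atTop (𝓝 0) := by
  have h1 : Tendsto (fun t : ℝ≥0 => Real.exp (-(γ₁ * t)) *
      (E.measure (E {0}ᶜ x) y).variation.real Set.univ) atTop (𝓝 0) := by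
    have h2 : Tendsto (fun t : ℝ≥0 => γ₁ * (t : ℝ)) atTop atTop :=
      (NNReal.tendsto_coe_atTop.2 tendsto_id).const_mul_atTop hgap.pos
    simpa using (Real.tendsto_exp_neg_atTop_nhds_zero.comp h2).mul_const
      ((E.measure (E {0}ᶜ x) y).variation.real Set.univ)
  exact squeeze_zero_norm (fun t => hE.norm_inner_semigroup_le hgap t x y) h1

/-- `P_∞ Λ = Λ E_{0}`. -/
theorem equilibrium_apply {P : ContractionSemigroup H} {Λ : K →L[ℂ] H} (hΛ : Intertwines P Q Λ)
    {γ₁ : ℝ} (hgap : HasSpectralGap Q.gen γ₁) (x : K) :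
    P.equilibrium (Λ x) = Λ (E {0} x) := by
  have hΛ' : ∀ t y, P t (Λ y) = Λ (Q t y) := fun t y =>
    congrArg (fun T : K →L[ℂ] H => T y) (hΛ t)
  refine Submodule.eq_starProjection_of_mem_of_inner_eq_zero (fun t => ?_) fun v hv => ?_
  · rw [hΛ', hE.semigroup_apply_singleton_zero]
  · have h1 : Λ x - Λ (E {0} x) = Λ (E {0}ᶜ x) := by
      rw [← map_sub]
      congr 1
      nth_rw 1 [← E.apply_add_compl (measurableSet_singleton 0) x]
      abel
    rw [h1, ← inner_conj_symm]
    -- As `P_t* v = v`, this number equals `⟪Λ* v, Q_t E_{0}ᶜ x⟫` for every `t`, which tends to `0`.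
    have h2 : inner ℂ v (Λ (E {0}ᶜ x)) = 0 := by
      refine tendsto_nhds_unique ?_
        (hE.tendsto_inner_semigroup hgap x (ContinuousLinearMap.adjoint Λ v))
      refine tendsto_const_nhds.congr fun t => ?_
      rw [ContinuousLinearMap.adjoint_inner_left, ← hΛ', ← ContinuousLinearMap.adjoint_inner_left (P t),
        P.adjoint_apply_of_mem_invariant hv]
    rw [h2, map_zero]

end ResolutionOfIdentity.IsResolutionOf

/-! ### The pseudo-inverse and the induced complex measures -/

theorem pseudoInverse_eq {Λ : K →L[ℂ] H} {f : (pseudoInverse Λ).domain} {x : K}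
    (hx : x ∈ Λ.kerᗮ) (hxf : Λ x = f) : pseudoInverse Λ f = x := by
  have hinj : LinearMap.ker
      (LinearPMap.mk Λ.kerᗮ ((Λ : K →ₗ[ℂ] H).domRestrict Λ.kerᗮ)).toFun = ⊥ := by
    rw [LinearMap.ker_eq_bot']
    rintro ⟨y, hy⟩ h
    have h' : y ∈ (Λ.ker ⊓ Λ.kerᗮ : Submodule ℂ K) := ⟨h, hy⟩
    rw [Λ.ker.inf_orthogonal_eq_bot, Submodule.mem_bot] at h'
    exact Subtype.ext h'
  exact LinearPMap.inverse_apply_eq hinj (x := ⟨x, hx⟩) hxf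

theorem pseudoInverse_mem (Λ : K →L[ℂ] H) (f : (pseudoInverse Λ).domain) :
    pseudoInverse Λ f ∈ Λ.kerᗮ ∧ Λ (pseudoInverse Λ f) = f := by
  have h : (f : H) ∈ LinearMap.range
      (LinearPMap.mk Λ.kerᗮ ((Λ : K →ₗ[ℂ] H).domRestrict Λ.kerᗮ)).toFun := by
    rw [← LinearPMap.inverse_domain]
    exact f.2
  obtain ⟨⟨x, hx⟩, hxf⟩ := h
  have hxf' : Λ x = f := hxf
  rw [pseudoInverse_eq hx hxf']
  exact ⟨hx, hxf'⟩

theorem inducedMeasure_eq (Λ : K →L[ℂ] H) (E : ResolutionOfIdentity K)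
    (f : (pseudoInverse Λ).domain) (g : H) :
    inducedMeasure Λ E f g =
      E.measure (pseudoInverse Λ f) (ContinuousLinearMap.adjoint Λ g) := by
  ext S
  rw [E.measure_apply, ContinuousLinearMap.adjoint_inner_left]
  rfl

/-- `(ker Λ)ᗮ` is the closure of `ran Λ*`, so this is properness in the form suited to `Λ†`. -/
theorem IsProper.apply_mem {Λ : K →L[ℂ] H} {E : ResolutionOfIdentity K} (h : IsProper Λ E)
    {S : Set ℂ} (hS : MeasurableSet S) {x : K} (hx : x ∈ Λ.kerᗮ) : E S x ∈ Λ.kerᗮ := by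
  have e : ∀ y, y ∈ Λ.kerᗮ ↔ y ∈ closure (Set.range (ContinuousLinearMap.adjoint Λ)) := by
    intro y
    rw [ContinuousLinearMap.orthogonal_ker]
    rfl
  rw [e] at hx ⊢
  exact h.invariant S hS x hx

/-! ### Bounded Borel functions and the decay estimate -/

theorem IsBoundedBorelOn.gapQuot {S : Set ℂ} {m : ℂ → ℂ} {t : ℝ≥0}
    (h : IsBoundedBorelOn S (expQuot m t)) (γ₁ : ℝ) : IsBoundedBorelOn S (gapQuot m γ₁ t) := by
  obtain ⟨h1, C, hC⟩ := h
  refine ⟨?_, C, fun γ hγ => (norm_indicator_le_norm_self _ _).trans (hC γ hγ)⟩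
  exact h1.indicator (measurable_subtype_coe
    (measurableSet_le measurable_const Complex.measurable_re))

theorem IsBoundedBorelOn.norm_le_supNormOn {S : Set ℂ} {φ : ℂ → ℂ} (h : IsBoundedBorelOn S φ)
    {γ : ℂ} (hγ : γ ∈ S) : ‖φ γ‖ ≤ supNormOn S φ := by
  obtain ⟨-, C, hC⟩ := h
  exact le_ciSup (f := fun γ : S => ‖φ γ‖)
    ⟨C, by rintro _ ⟨⟨z, hz⟩, rfl⟩; exact hC z hz⟩ ⟨γ, hγ⟩

theorem supNormOn_nonneg (S : Set ℂ) (φ : ℂ → ℂ) : 0 ≤ supNormOn S φ :=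
  Real.iSup_nonneg fun _ => norm_nonneg _

namespace ResolutionOfIdentity.IsResolutionOf

open UnboundedOp

variable {E : ResolutionOfIdentity K} {Q : ContractionSemigroup K} (hE : E.IsResolutionOf Q.gen)
  {P : ContractionSemigroup H} {Λ : K →L[ℂ] H} (hΛ : Intertwines P Q Λ)

include hE hΛ

theorem inner_intertwined_apply (hre : ∀ γ ∈ spectrum Q.gen, 0 ≤ γ.re) (t : ℝ≥0) (x : K) (g : H) :
    inner ℂ g (P t (Λ x)) =
      ∫ᵛ γ in spectrum Q.gen, Complex.exp (-(γ * ((t : ℝ) : ℂ)))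
        ∂[ContinuousLinearMap.mul ℝ ℂ; E.measure x (ContinuousLinearMap.adjoint Λ g)] := by
  rw [← hE.inner_semigroup_apply hre, ContinuousLinearMap.adjoint_inner_left]
  exact congrArg (fun T : K →L[ℂ] H => inner ℂ g (T x)) (hΛ t)

/-- The nsa spectral integral of `e^{-γ t}` is the restriction of `P_t` to the range of `Λ`. -/
theorem isSpectralIntegral_exp (hre : ∀ γ ∈ spectrum Q.gen, 0 ≤ γ.re) (t : ℝ≥0) :
    IsSpectralIntegral Λ E (spectrum Q.gen) (fun γ => Complex.exp (-(γ * ((t : ℝ) : ℂ))))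
      (LinearPMap.mk (LinearMap.range (Λ : K →ₗ[ℂ] H))
        ((P t : H →ₗ[ℂ] H).domRestrict (LinearMap.range (Λ : K →ₗ[ℂ] H)))) where
  domain_eq := rfl
  integrable f g := by
    rw [inducedMeasure_eq]
    refine integrableOn_of_bound (isClosed_spectrum Q.gen).measurableSet (by fun_prop) (C := 1)
      fun γ hγ => ?_
    rw [norm_exp_neg_mul, Real.exp_le_one_iff, neg_nonpos]
    exact mul_nonneg (hre γ hγ) t.2
  inner_eq f g hf := by
    rw [inducedMeasure_eq, ← hE.inner_intertwined_apply hΛ hre, (pseudoInverse_mem Λ f).2]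
    rfl

/-- On the support of `E_{0}ᶜ x` one has `e^{-γt} = M_t(γ) m(γ)`; taking out the supremum of `|M_t|`
leaves exactly the integral controlled by (a). -/
theorem norm_semigroup_apply_le {γ₁ : ℝ} {m : ℂ → ℂ} (hproper : IsProper Λ E)
    (hgap : HasSpectralGap Q.gen γ₁)
    (ha : ∀ (f : (pseudoInverse Λ).domain) (g : H),
      ∫⁻ γ in spectrum Q.gen, ‖m γ‖ₑ ∂(inducedMeasure Λ E f g).variation
        ≤ ENNReal.ofReal (‖(f : H)‖ * ‖g‖))
    (hm0 : ∀ γ ∈ spectrum Q.gen, m γ ≠ 0) {t : ℝ≥0}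
    (hb : IsBoundedBorelOn (spectrum Q.gen) (gapQuot m γ₁ t)) {x : K} (hx : x ∈ Λ.kerᗮ) :
    ‖P t (Λ (E {0}ᶜ x))‖ ≤
      supNormOn (spectrum Q.gen) (gapQuot m γ₁ t) * ‖Λ (E {0}ᶜ x)‖ := by
  have hσ := (isClosed_spectrum Q.gen).measurableSet
  set M := supNormOn (spectrum Q.gen) (gapQuot m γ₁ t) with hM
  have hM0 : 0 ≤ M := supNormOn_nonneg _ _
  set y := E {0}ᶜ x with hy
  -- The vector to be estimated is its own test vector, giving `‖g‖² ≤ M ‖Λy‖ ‖g‖`.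
  set g := P t (Λ y) with hg
  have hdom : Λ y ∈ (pseudoInverse Λ).domain := by
    rw [pseudoInverse_domain]
    exact ⟨y, rfl⟩
  have ha' := ha ⟨Λ y, hdom⟩ g
  -- Properness enters here: `y ⊥ ker Λ`, hence `Λ†Λy = y`, and (a) becomes a bound for a measure of
  -- `E`.
  rw [inducedMeasure_eq, pseudoInverse_eq (x := y)
    (hproper.apply_mem (measurableSet_singleton 0).compl hx) rfl] at ha'
  have h1 := hE.inner_intertwined_apply hΛ hgap.re_nonneg t y g
  rw [← hg] at h1
  have h2 := VectorMeasure.enorm_setIntegral_le_lintegral_enorm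
    (μ := E.measure y (ContinuousLinearMap.adjoint Λ g)) (B := ContinuousLinearMap.mul ℝ ℂ)
    (s := spectrum Q.gen) (f := fun γ => Complex.exp (-(γ * ((t : ℝ) : ℂ))))
  have h3 : ∫⁻ γ in spectrum Q.gen, ‖Complex.exp (-(γ * ((t : ℝ) : ℂ)))‖ₑ
      ∂(E.measure y (ContinuousLinearMap.adjoint Λ g)).variation ≤
      ENNReal.ofReal M * ∫⁻ γ in spectrum Q.gen, ‖m γ‖ₑ
        ∂(E.measure y (ContinuousLinearMap.adjoint Λ g)).variation := by
    rw [← lintegral_const_mul' _ _ ENNReal.ofReal_ne_top]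
    refine lintegral_mono_ae ?_
    rw [ae_restrict_iff' hσ]
    filter_upwards [hE.ae_re_ge hgap x (ContinuousLinearMap.adjoint Λ g)] with γ hγ hγσ
    rw [← ofReal_norm, ← ofReal_norm, ← ENNReal.ofReal_mul hM0]
    refine ENNReal.ofReal_le_ofReal ?_
    have h4 := hb.norm_le_supNormOn hγσ
    rw [gapQuot, Set.indicator_of_mem (by exact hγ), expQuot, norm_div,
      div_le_iff₀ (norm_pos_iff.2 (hm0 γ hγσ))] at h4
    exact h4
  have h5 : ‖ContinuousLinearMap.mul ℝ ℂ‖ₑ ≤ 1 := by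
    rw [← ofReal_norm, ← ENNReal.ofReal_one]
    exact ENNReal.ofReal_le_ofReal (ContinuousLinearMap.opNorm_mul_le ℝ ℂ)
  have h6 : ENNReal.ofReal ‖inner ℂ g g‖ ≤ ENNReal.ofReal (M * (‖Λ y‖ * ‖g‖)) := by
    rw [ofReal_norm, h1, ENNReal.ofReal_mul hM0]
    calc _ ≤ _ := h2
      _ ≤ 1 * (ENNReal.ofReal M * ENNReal.ofReal (‖Λ y‖ * ‖g‖)) := by
        gcongr
        exact h3.trans (by gcongr)
      _ = _ := one_mul _
  rw [ENNReal.ofReal_le_ofReal_iff (by positivity), inner_self_eq_norm_sq_to_K] at h6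
  have h7 : ‖g‖ ^ 2 ≤ M * (‖Λ y‖ * ‖g‖) := by simpa using h6
  rcases eq_or_lt_of_le (norm_nonneg g) with h | h
  · rw [← h]
    positivity
  · nlinarith

end ResolutionOfIdentity.IsResolutionOf

end

/-! ### Passage from the range of `Λ` to the whole space. -/

theorem mainTheorem1
    {H K : Type*} [NormedAddCommGroup H] [InnerProductSpace ℂ H] [CompleteSpace H]
    [NormedAddCommGroup K] [InnerProductSpace ℂ K] [CompleteSpace K]
    (P : ContractionSemigroup H) (Q : ContractionSemigroup K) (Λ : K →L[ℂ] H)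
    (E : ResolutionOfIdentity K) (γ₁ : ℝ) (m : ℂ → ℂ) (Tm : ℝ)
    (hΛ : Intertwines P Q Λ)
    (hnormal : UnboundedOp.IsNormal Q.gen)
    (hE : E.IsResolutionOf Q.gen)
    (hproper : IsProper Λ E)
    (hgap : UnboundedOp.HasSpectralGap Q.gen γ₁)
    (hm : IsBoundedBorelOn (UnboundedOp.spectrum Q.gen) m)
    (ha : ∀ (f : (pseudoInverse Λ).domain) (g : H),
      ∫⁻ γ in UnboundedOp.spectrum Q.gen, ‖m γ‖ₑ ∂(inducedMeasure Λ E f g).variation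
        ≤ ENNReal.ofReal (‖(f : H)‖ * ‖g‖))
    (hTm : 0 < Tm)
    (hm0 : ∀ γ ∈ UnboundedOp.spectrum Q.gen, m γ ≠ 0)
    (hb : ∀ t : ℝ≥0, Tm < t → IsBoundedBorelOn (UnboundedOp.spectrum Q.gen) (expQuot m t)) :
    ∀ t : ℝ≥0, Tm < t →
      (∃ T : H →ₗ.[ℂ] H,
        IsSpectralIntegral Λ E (UnboundedOp.spectrum Q.gen)
          (fun γ => Complex.exp (-(γ * ((t : ℝ) : ℂ)))) T ∧
        ∃ B : H →L[ℂ] H, ∀ f : T.domain, B f = T f) ∧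
      IsBoundedBorelOn (UnboundedOp.spectrum Q.gen) (gapQuot m γ₁ t) ∧
      (∀ f : H, ‖P t f - P.equilibrium f‖ ≤
        supNormOn (UnboundedOp.spectrum Q.gen) (gapQuot m γ₁ t) * ‖f - P.equilibrium f‖) ∧
      ((γ₁ : ℂ) ∈ UnboundedOp.spectrum Q.gen →
        (∀ γ ∈ UnboundedOp.spectrum Q.gen, ‖gapQuot m γ₁ t γ‖ ≤ ‖gapQuot m γ₁ t γ₁‖) →
        ∀ f : H, ‖P t f - P.equilibrium f‖ ≤
          1 / ‖m γ₁‖ * Real.exp (-(γ₁ * t)) * ‖f - P.equilibrium f‖) := by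
  intro t ht
  have hgapb := (hb t ht).gapQuot γ₁
  have hdecay : ∀ f : H, ‖P t f - P.equilibrium f‖ ≤
      supNormOn (UnboundedOp.spectrum Q.gen) (gapQuot m γ₁ t) * ‖f - P.equilibrium f‖ := by
    have hclosed : IsClosed {f : H | ‖P t f - P.equilibrium f‖ ≤
        supNormOn (UnboundedOp.spectrum Q.gen) (gapQuot m γ₁ t) * ‖f - P.equilibrium f‖} :=
      isClosed_le (by fun_prop) (by fun_prop)
    refine fun f => hproper.dense.induction_on f hclosed fun x₀ => ?_
    have hdom : Λ x₀ ∈ (pseudoInverse Λ).domain := by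
      rw [pseudoInverse_domain]
      exact ⟨x₀, rfl⟩
    -- The preimage `x₀` is replaced by the one orthogonal to `ker Λ`, with the same image.
    obtain ⟨hx, hxf⟩ := pseudoInverse_mem Λ ⟨Λ x₀, hdom⟩
    set x := pseudoInverse Λ ⟨Λ x₀, hdom⟩
    have hxf' : Λ x = Λ x₀ := hxf
    rw [← hxf', hE.equilibrium_apply hΛ hgap]
    have h1 : Λ x - Λ (E {0} x) = Λ (E {0}ᶜ x) := by
      rw [sub_eq_iff_eq_add, ← map_add, add_comm, E.apply_add_compl (measurableSet_singleton 0)]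
    have h2 : P t (Λ (E {0} x)) = Λ (E {0} x) := by
      have h3 : P t (Λ (E {0} x)) = Λ (Q t (E {0} x)) :=
        congrArg (fun T : K →L[ℂ] H => T (E {0} x)) (hΛ t)
      rw [h3, hE.semigroup_apply_singleton_zero]
    have h4 : P t (Λ x) - Λ (E {0} x) = P t (Λ (E {0}ᶜ x)) := by
      rw [← h1, map_sub, h2]
    rw [h1, h4]
    exact hE.norm_semigroup_apply_le hΛ hproper hgap ha hm0 hgapb hx
  refine ⟨⟨_, hE.isSpectralIntegral_exp hΛ hgap.re_nonneg t, P t, fun _ => rfl⟩, hgapb, hdecay,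
    fun hγ hmax f => (hdecay f).trans (mul_le_mul_of_nonneg_right ?_ (norm_nonneg _))⟩
  -- Bounding a real supremum by a bound for its terms requires a nonempty index set.
  have : Nonempty (UnboundedOp.spectrum Q.gen) := ⟨⟨_, hγ⟩⟩
  refine (ciSup_le fun γ : UnboundedOp.spectrum Q.gen => hmax γ γ.2).trans (le_of_eq ?_)
  rw [gapQuot, Set.indicator_of_mem (by simp), expQuot, norm_div, norm_exp_neg_mul,
    Complex.ofReal_re]
  ring
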